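/- Throughout, $G$ is a totally disconnected locally compact (Hausdorff) group. **Definitions.** Subgroups $H,K\le G$ are *locally equivalent* if $H\cap U=K\cap U$ for some open subgroup $U$; $[H]$ is the class of $H$, and $[K]\le[H]$ means $K\cap U\le H$ for some open subgroup $U$. A subgroup is *locally normal* if it is compact with open normaliser; $\mathcal{LN}(G)$ is the set of classes of locally normal subgroups. For subgroups $H,K$, $\mathrm{QC}_H(K)$ is the set of $h\in H$ that centralise $K\cap U$ for some open subgroup $U$; $\mathrm{QC}_G(K)$ depends only on $[K]$, and $[K]^\bot:=[\mathrm{QC}_G(K)]$. $G$ is *locally C-stable* if the only element of $G$ with open centraliser is $1$ and, for every locally normal $H$, the group $\mathrm{QC}_G(H)\cap\mathrm{QC}_G(\mathrm C_G(H))$ is discrete and torsion-free. Put $\mathcal{LC}(G)=\{\alpha^\bot:\alpha\in\mathcal{LN}(G)\}$, and let $\mathcal{LD}(G)$ be the set of classes $[K]$ where $K$ is locally normal and is a direct factor of a closed subgroup of finite index of some compact open subgroup of $G$. Both are partially ordered by the order on local classes, and $G$ acts on both by conjugation. Let $G$ act by automorphisms on a Boolean algebra $\mathcal A$ with kernel $N$,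 and let $\mathrm{rist}_G(a)=\{g: gb=b \text{ for all } b\le a^\bot\}$, where $a^\bot$ is the complement of $a$. The action is *smooth* if all point stabilisers $G_a$ are open; *weakly branch* if it is smooth and $\mathrm{rist}_G(a)\ne N$ for all $a\ne 0$; *locally branch* if it is weakly branch and $\mathrm{rist}_G(a)\,\mathrm{rist}_G(a^\bot)$ is open for all $a\in\mathcal A$. An action by homeomorphisms on a profinite space $X$ is weakly (locally) branch if the action on the Boolean algebra $\mathrm{Clop}(X)$ of clopen sets is so. $\mathfrak S(\mathcal A)$ is the Stone space (space of ultrafilters) of $\mathcal A$, with the induced action. **Theorem.** Let $G$ be locally C-stable. Then $\mathcal{LC}(G)$ and $\mathcal{LD}(G)$, with the orders above, are Boolean algebras, with complementation $\bot$, on which $G$ acts by automorphisms, and: 1. If $G$ acts faithfully on $\mathcal{LC}(G)$, then the induced action of $G$ on $\mathfrak S(\mathcal{LC}(G))$ is a faithful weakly branch action. 2. Every faithful weakly branch action of $G$ on a Boolean algebra $\mathcal A$ is $G$-equivariantly isomorphic to the action of $G$ on some $G$-invariant subalgebra of $\mathcal{LC}(G)$, and $\mathfrak S(\mathcal A)$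 is the image of $\mathfrak S(\mathcal{LC}(G))$ under a continuous $G$-equivariant surjection. If $X$ is a profinite space with a faithful weakly branch action of $G$, then $\mathrm{Clop}(X)$ is $G$-equivariantly isomorphic to a $G$-invariant subalgebra of $\mathcal{LC}(G)$, and there is a continuous $G$-equivariant surjection $\mathfrak S(\mathcal{LC}(G))\to X$. 3. Let $G$ have a faithful locally branch action on a Boolean algebra $\mathcal A$ (respectively, on a profinite space $X$, and put $\mathcal A=\mathrm{Clop}(X)$). Suppose that $G$ is $\sigma$-compact or, more generally, that for every $a\in\mathcal A$ there is a compact open subgroup $U\le G$ such that $(\mathrm{rist}_G(a)\cap U)\,(\mathrm{rist}_G(a^\bot)\cap U)$ is open in $G$. Then $\mathcal A$ is $G$-equivariantly isomorphic to a $G$-invariant subalgebra of $\mathcal{LD}(G)$. -/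

import Mathlib

open scoped Pointwise

namespace TDLC

universe u v

section Subgroups

variable {G : Type u} [Group G] [TopologicalSpace G]

/-- A locally normal subgroup: a compact subgroup whose normaliser is open. -/
def IsLocallyNormal (H : Subgroup G) : Prop :=
  IsCompact (H : Set G) ∧ IsOpen (Subgroup.normalizer (H : Set G) : Set G)

/-- Two subgroups are locally equivalent if they have the same intersection with some open subgroup.
(In a totally disconnected locally compact group every open subgroup contains a compact open one,
so compact open subgroups give the same relation.) -/
def LocallyEquivalent (H K : Subgroup G) : Prop :=
  ∃ U : OpenSubgroup G, H ⊓ (U : Subgroup G) = K ⊓ (U : Subgroup G)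

theorem locallyEquivalent_equivalence : Equivalence (LocallyEquivalent (G := G)) where
  refl _ := ⟨⊤, rfl⟩
  symm := fun ⟨U, h⟩ => ⟨U, h.symm⟩
  trans := by
    rintro H K L ⟨U, hU⟩ ⟨V, hV⟩
    refine ⟨U ⊓ V, ?_⟩
    rw [OpenSubgroup.toSubgroup_inf, ← inf_assoc, hU, inf_right_comm, hV, inf_right_comm, inf_assoc]

instance localSetoid (G : Type u) [Group G] [TopologicalSpace G] : Setoid (Subgroup G) :=
  ⟨LocallyEquivalent, locallyEquivalent_equivalence⟩

/-- Local equivalence classes `[H]` of subgroups of `G`. -/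
def LocalClass (G : Type u) [Group G] [TopologicalSpace G] : Type u :=
  Quotient (localSetoid G)

/-- The local equivalence class `[H]`. -/
def LocalClass.mk (H : Subgroup G) : LocalClass G := Quotient.mk (localSetoid G) H

/-- `[K] ≤ [H]` iff `K ∩ U ≤ H` for some open subgroup `U`. -/
instance : PartialOrder (LocalClass G) where
  le := Quotient.lift₂
    (fun K H => ∃ U : OpenSubgroup G, K ⊓ (U : Subgroup G) ≤ H) (by
      have key : ∀ K H K' H' : Subgroup G, LocallyEquivalent K K' → LocallyEquivalent H H' →
          (∃ U : OpenSubgroup G, K ⊓ (U : Subgroup G) ≤ H) →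
          ∃ U : OpenSubgroup G, K' ⊓ (U : Subgroup G) ≤ H' := by
        rintro K H K' H' ⟨V, hV⟩ ⟨W, hW⟩ ⟨U, hU⟩
        refine ⟨U ⊓ V ⊓ W, fun x hx => ?_⟩
        simp only [OpenSubgroup.toSubgroup_inf, Subgroup.mem_inf] at hx
        obtain ⟨h1, ⟨h2, h3⟩, h4⟩ := hx
        have h5 : x ∈ K ⊓ (V : Subgroup G) := hV ▸ ⟨h1, h3⟩
        have h6 : x ∈ H' ⊓ (W : Subgroup G) := hW ▸ ⟨hU ⟨h5.1, h2⟩, h4⟩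
        exact h6.1
      intro K H K' H' hK hH
      exact propext ⟨key K H K' H' hK hH,
        key K' H' K H (locallyEquivalent_equivalence.symm hK)
          (locallyEquivalent_equivalence.symm hH)⟩)
  le_refl := by
    rintro ⟨H⟩
    exact ⟨⊤, inf_le_left⟩
  le_trans := by
    rintro ⟨H⟩ ⟨K⟩ ⟨L⟩ ⟨U, hU⟩ ⟨V, hV⟩
    refine ⟨U ⊓ V, fun x hx => ?_⟩
    simp only [OpenSubgroup.toSubgroup_inf, Subgroup.mem_inf] at hx
    exact hV ⟨hU ⟨hx.1, hx.2.1⟩, hx.2.2⟩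
  le_antisymm := by
    rintro ⟨H⟩ ⟨K⟩ ⟨U, hU⟩ ⟨V, hV⟩
    refine Quotient.sound ⟨U ⊓ V, ?_⟩
    ext x
    simp only [OpenSubgroup.toSubgroup_inf, Subgroup.mem_inf]
    exact ⟨fun h => ⟨hU ⟨h.1, h.2.1⟩, h.2⟩, fun h => ⟨hV ⟨h.1, h.2.2⟩, h.2⟩⟩

/-- The structure lattice `LN(G)`: the local classes of locally normal subgroups. -/
def structureLattice (G : Type u) [Group G] [TopologicalSpace G] : Set (LocalClass G) :=
  {α | ∃ H : Subgroup G, IsLocallyNormal H ∧ LocalClass.mk H = α}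

/-- The quasi-centraliser `QC_H(K)`: the elements of `H` that centralise `K ∩ U` for some open
subgroup `U`. -/
def quasiCentraliser (H K : Subgroup G) : Subgroup G where
  carrier := {g | g ∈ H ∧ ∃ U : OpenSubgroup G,
    g ∈ Subgroup.centralizer ((K ⊓ (U : Subgroup G) : Subgroup G) : Set G)}
  one_mem' := ⟨H.one_mem, ⊤, Subgroup.one_mem _⟩
  mul_mem' := by
    rintro a b ⟨ha, U, hU⟩ ⟨hb, V, hV⟩
    refine ⟨H.mul_mem ha hb, U ⊓ V, Subgroup.mul_mem _ ?_ ?_⟩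
    · exact Subgroup.centralizer_le (SetLike.coe_subset_coe.2
        (inf_le_inf_left K (inf_le_left : (U : Subgroup G) ⊓ V ≤ U))) hU
    · exact Subgroup.centralizer_le (SetLike.coe_subset_coe.2
        (inf_le_inf_left K (inf_le_right : (U : Subgroup G) ⊓ V ≤ V))) hV
  inv_mem' := by
    rintro a ⟨ha, U, hU⟩
    exact ⟨H.inv_mem ha, U, Subgroup.inv_mem _ hU⟩

/-- `QC_G(K)` depends only on the local class of `K`. -/
theorem quasiCentraliser_congr {H K K' : Subgroup G} (h : LocallyEquivalent K K') :
    quasiCentraliser H K = quasiCentraliser H K' := by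
  have key : ∀ K K' : Subgroup G, LocallyEquivalent K K' →
      quasiCentraliser H K ≤ quasiCentraliser H K' := by
    rintro K K' ⟨V, hV⟩ g ⟨hg, U, hU⟩
    refine ⟨hg, U ⊓ V, Subgroup.centralizer_le (fun x hx => ?_) hU⟩
    have h5 : x ∈ K ⊓ (V : Subgroup G) := hV ▸ ⟨hx.1, hx.2.2⟩
    exact ⟨h5.1, hx.2.1⟩
  exact le_antisymm (key _ _ h) (key _ _ (locallyEquivalent_equivalence.symm h))

/-- The map `α ↦ α^⊥ = [QC_G(α)]`. -/
def LocalClass.perp : LocalClass G → LocalClass G :=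
  Quotient.lift (fun H => LocalClass.mk (quasiCentraliser ⊤ H))
    fun _ _ h => congrArg LocalClass.mk (quasiCentraliser_congr h)

/-- `G` has trivial quasi-centre: the only element with open centraliser is the identity. -/
def TrivialQuasiCentre (G : Type u) [Group G] [TopologicalSpace G] : Prop :=
  ∀ g : G, IsOpen (Subgroup.centralizer {g} : Set G) → g = 1

/-- A (closed) subgroup `H` is C-stable if `QC_G(H) ∩ QC_G(C_G(H))` is discrete and torsion-free. -/
def IsCStable (H : Subgroup G) : Prop :=
  DiscreteTopology
      ↥(quasiCentraliser ⊤ H ⊓ quasiCentraliser ⊤ (Subgroup.centralizer (H : Set G))) ∧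
    ∀ x ∈ quasiCentraliser ⊤ H ⊓ quasiCentraliser ⊤ (Subgroup.centralizer (H : Set G)),
      IsOfFinOrder x → x = 1

/-- `G` is locally C-stable: it has trivial quasi-centre and all its locally normal subgroups are
C-stable. -/
def IsLocallyCStable (G : Type u) [Group G] [TopologicalSpace G] : Prop :=
  TrivialQuasiCentre G ∧ ∀ H : Subgroup G, IsLocallyNormal H → IsCStable H

/-- `K` is a direct factor of `L`: `L` is the internal direct product of `K` and a subgroup `M`. -/
def IsDirectFactor (K L : Subgroup G) : Prop :=
  ∃ M : Subgroup G, (∀ k ∈ K, ∀ m ∈ M, k * m = m * k) ∧ K ⊓ M = ⊥ ∧ K ⊔ M = L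

/-- `K` is an almost direct factor of the closed subgroup `H`: it is a direct factor of a closed
subgroup `L` of finite index in `H`. -/
def IsAlmostDirectFactor (K H : Subgroup G) : Prop :=
  ∃ L : Subgroup G, L ≤ H ∧ IsClosed (L : Set G) ∧ L.relIndex H ≠ 0 ∧ IsDirectFactor K L

/-- The centraliser lattice `LC(G) = {α^⊥ | α ∈ LN(G)}`. -/
def CentraliserLattice (G : Type u) [Group G] [TopologicalSpace G] : Type u :=
  {γ : LocalClass G // ∃ α ∈ structureLattice G, γ = α.perp}

/-- The local class underlying an element of `LC(G)`. -/
def CentraliserLattice.cls (γ : CentraliserLattice G) : LocalClass G := γ.1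

/-- The local decomposition lattice `LD(G)`: the classes of the locally normal subgroups that are
almost direct factors of a compact open subgroup of `G`. -/
def DecompositionLattice (G : Type u) [Group G] [TopologicalSpace G] : Type u :=
  {γ : LocalClass G // ∃ K U : Subgroup G, IsLocallyNormal K ∧ IsOpen (U : Set G) ∧
    IsCompact (U : Set G) ∧ IsAlmostDirectFactor K U ∧ γ = LocalClass.mk K}

/-- The local class underlying an element of `LD(G)`. -/
def DecompositionLattice.cls (γ : DecompositionLattice G) : LocalClass G := γ.1

/-- Conjugation on local classes: `g [H] = [g H g⁻¹]`. -/
def LocalClass.conj [ContinuousMul G] (g : G) : LocalClass G → LocalClass G :=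
  Quotient.map' (Subgroup.map (MulAut.conj g).toMonoidHom) (by
    rintro H K ⟨U, hU⟩
    have hc : Continuous (MulAut.conj g⁻¹).toMonoidHom := by
      change Continuous fun x => g⁻¹ * x * g⁻¹⁻¹
      fun_prop
    refine ⟨U.comap (MulAut.conj g⁻¹).toMonoidHom hc, ?_⟩
    have key : ∀ L : Subgroup G, L.map (MulAut.conj g).toMonoidHom ⊓
        (U.comap (MulAut.conj g⁻¹).toMonoidHom hc : Subgroup G) =
        (L ⊓ (U : Subgroup G)).map (MulAut.conj g).toMonoidHom := by
      intro L
      ext x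
      constructor
      · rintro ⟨⟨y, hy, rfl⟩, hx⟩
        refine ⟨y, ⟨hy, ?_⟩, rfl⟩
        have hx' : g⁻¹ * (g * y * g⁻¹) * g⁻¹⁻¹ ∈ U := hx
        have e : g⁻¹ * (g * y * g⁻¹) * g⁻¹⁻¹ = y := by group
        rw [e] at hx'
        exact hx'
      · rintro ⟨y, ⟨hy, hyU⟩, rfl⟩
        refine ⟨⟨y, hy, rfl⟩, ?_⟩
        change g⁻¹ * (g * y * g⁻¹) * g⁻¹⁻¹ ∈ U
        have e : g⁻¹ * (g * y * g⁻¹) * g⁻¹⁻¹ = y := by group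
        rw [e]
        exact hyU
    rw [key, key, hU])

end Subgroups

section Stone

variable {A : Type v} [BooleanAlgebra A]

/-- The Stone space of a Boolean algebra: its points are the ultrafilters, that is, the filters
that contain exactly one of `a`, `aᶜ` for every `a`. -/
@[ext]
structure StoneSpace (A : Type v) [BooleanAlgebra A] where
  carrier : Set A
  top_mem : ⊤ ∈ carrier
  inf_mem : ∀ a ∈ carrier, ∀ b ∈ carrier, a ⊓ b ∈ carrier
  mem_of_le : ∀ a ∈ carrier, ∀ b, a ≤ b → b ∈ carrier
  compl_mem_iff : ∀ a, aᶜ ∈ carrier ↔ a ∉ carrier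

/-- The sets `{p | a ∈ p}`, for `a` in the algebra, form a base of the topology. -/
instance : TopologicalSpace (StoneSpace A) :=
  TopologicalSpace.generateFrom {s | ∃ a : A, s = {p : StoneSpace A | a ∈ p.carrier}}

/-- The image `{e a | a ∈ p}` of an ultrafilter `p` under an automorphism `e`. -/
def StoneSpace.map (e : A ≃o A) (p : StoneSpace A) : StoneSpace A where
  carrier := {a | e.symm a ∈ p.carrier}
  top_mem := by simpa using p.top_mem
  inf_mem a ha b hb := by simpa using p.inf_mem _ ha _ hb
  mem_of_le a ha b hab := p.mem_of_le _ ha _ (e.symm.monotone hab)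
  compl_mem_iff a := by
    have h : e.symm aᶜ = (e.symm a)ᶜ := map_compl' e.symm a
    simpa [h] using p.compl_mem_iff (e.symm a)

theorem StoneSpace.continuous_map (e : A ≃o A) : Continuous (StoneSpace.map e) := by
  refine continuous_generateFrom_iff.2 ?_
  rintro _ ⟨a, rfl⟩
  exact TopologicalSpace.isOpen_generateFrom_of_mem ⟨e.symm a, rfl⟩

/-- The homomorphism from the automorphisms of a Boolean algebra to the homeomorphisms of its Stone
space. -/
def stoneHom (A : Type v) [BooleanAlgebra A] : (A ≃o A) →* (StoneSpace A ≃ₜ StoneSpace A) where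
  toFun e :=
    { toFun := StoneSpace.map e
      invFun := StoneSpace.map e.symm
      left_inv := fun p => by ext a; simp [StoneSpace.map]
      right_inv := fun p => by ext a; simp [StoneSpace.map]
      continuous_toFun := StoneSpace.continuous_map e
      continuous_invFun := StoneSpace.continuous_map e.symm }
  map_one' := rfl
  map_mul' _ _ := rfl

/-- The homomorphism from the homeomorphisms of a space to the automorphisms of its Boolean algebra
of clopen subsets, `s ↦ h(s)`. -/
def clopenHom (X : Type v) [TopologicalSpace X] :
    (X ≃ₜ X) →* (TopologicalSpace.Clopens X ≃o TopologicalSpace.Clopens X) where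
  toFun h :=
    { toFun := fun s => ⟨h.symm ⁻¹' (s : Set X), s.isClopen.preimage h.symm.continuous⟩
      invFun := fun s => ⟨h ⁻¹' (s : Set X), s.isClopen.preimage h.continuous⟩
      left_inv := fun s => TopologicalSpace.Clopens.ext (by ext x; simp)
      right_inv := fun s => TopologicalSpace.Clopens.ext (by ext x; simp)
      map_rel_iff' := by
        intro s t
        change h.symm ⁻¹' (s : Set X) ⊆ h.symm ⁻¹' (t : Set X) ↔ (s : Set X) ⊆ t
        exact Set.preimage_subset_preimage_iff (by simp [h.symm.surjective.range_eq]) }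
  map_one' := rfl
  map_mul' _ _ := rfl

end Stone

section Actions

variable {G : Type u} [Group G] [TopologicalSpace G] {A : Type v} [BooleanAlgebra A]

/-- The rigid stabiliser of `a`: the elements fixing every `b ≤ aᶜ`. -/
def rist (ρ : G →* (A ≃o A)) (a : A) : Subgroup G where
  carrier := {g | ∀ b ≤ aᶜ, ρ g b = b}
  one_mem' b _ := by simp
  mul_mem' {g h} hg hh b hb := by
    rw [map_mul, RelIso.mul_apply, hh b hb, hg b hb]
  inv_mem' {g} hg b hb := by
    have h := congrArg (ρ g⁻¹) (hg b hb)
    rw [← RelIso.mul_apply, ← map_mul, inv_mul_cancel, map_one, RelIso.one_apply] at h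
    exact h.symm

/-- The action is smooth: every point stabiliser is open. -/
def IsSmooth (ρ : G →* (A ≃o A)) : Prop :=
  ∀ a : A, IsOpen {g : G | ρ g a = a}

/-- The action is weakly branch: it is smooth, and the rigid stabiliser of every nonzero element
contains an element outside the kernel of the action. -/
def IsWeaklyBranch (ρ : G →* (A ≃o A)) : Prop :=
  IsSmooth ρ ∧ ∀ a : A, a ≠ ⊥ → ∃ g ∈ rist ρ a, g ∉ ρ.ker

/-- The action is locally branch: it is weakly branch and `rist(a) rist(aᶜ)` is open for all `a`. -/
def IsLocallyBranch (ρ : G →* (A ≃o A)) : Prop :=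
  IsWeaklyBranch ρ ∧ ∀ a : A, IsOpen ((rist ρ a : Set G) * (rist ρ aᶜ : Set G))

/-- For every `a` there is a compact open subgroup `U` such that `rist_U(a) rist_U(aᶜ)` is open,
where `rist_U(a) = rist(a) ∩ U`. -/
def HasLocallyOpenRistProducts (ρ : G →* (A ≃o A)) : Prop :=
  ∀ a : A, ∃ U : Subgroup G, IsOpen (U : Set G) ∧ IsCompact (U : Set G) ∧
    IsOpen (((rist ρ a ⊓ U : Subgroup G) : Set G) * ((rist ρ aᶜ ⊓ U : Subgroup G) : Set G))

/-- The action `ρ` is equivariantly isomorphic to the action `τ` restricted to some invariant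
Boolean subalgebra. -/
def OccursOnSubalgebra {M : Type*} [BooleanAlgebra M] (ρ : G →* (A ≃o A)) (τ : G →* (M ≃o M)) :
    Prop :=
  ∃ B : BooleanSubalgebra M, (∀ g, ∀ b ∈ B, τ g b ∈ B) ∧
    ∃ e : A ≃o B, ∀ (g : G) (a : A), ((e (ρ g a) : B) : M) = τ g (e a : M)

/-- The `G`-space `X` is a `G`-equivariant quotient (continuous surjective image) of the Stone space
of `M`. -/
def IsQuotientOfStoneSpace {M : Type*} [BooleanAlgebra M] {X : Type*} [TopologicalSpace X]
    (τ : G →* (M ≃o M)) (σ : G →* (X ≃ₜ X)) : Prop :=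
  ∃ f : StoneSpace M → X, Continuous f ∧ Function.Surjective f ∧
    ∀ (g : G) (p : StoneSpace M), f (stoneHom M (τ g) p) = σ g (f p)

end Actions

end TDLC

open TDLC

/-!
For a locally normal subgroup `H` of a locally C-stable group, the quasi-centraliser of `H` agrees
near `1` with the centraliser of a small enough `H ∩ U`, and `H ∩ C_G(H) = 1`. Hence
`α ⊓ β = ⊥ ↔ α ≤ β^⊥` for classes of locally normal subgroups, and any set of such classes closed
under meets and `⊥`, on which `⊥` is involutive, is a Boolean algebra. For the classes of direct
factors, closure under meets rests on the fact that a decomposition `K' × M'` of an open subgroup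
is inherited by the factors of a smaller open subgroup `K × M`.

A non-trivial element of a small `H ∩ U` commutes with a representative of `[H]^⊥`, so it fixes
every class below `[H]^⊥`: the conjugation action has large rigid stabilisers and is weakly branch.
Conversely, for a faithful weakly branch action on `𝒜` one has `QC_G(rist(a)) = rist(a^⊥)`, so that
`a ↦ [rist(a)]` embeds `𝒜` in `LC(G)`, and in `LD(G)` as soon as `rist(a) rist(a^⊥)` is open in a
sufficiently local sense, which the open mapping theorem provides for `σ`-compact groups. The
assertions on spaces are the Stone duals of these.
-/

namespace TDLC

universe u v w

section CommutingSubgroups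

open Subgroup

variable {G : Type u} [Group G] {H K M U : Subgroup G}

theorem le_normalizer_inf (hH : U ≤ normalizer (H : Set G)) (hK : U ≤ normalizer (K : Set G)) :
    U ≤ normalizer ((H ⊓ K : Subgroup G) : Set G) :=
  (le_inf hH hK).trans inf_normalizer_le_normalizer_inf

theorem le_normalizer_centralizer (h : U ≤ normalizer (H : Set G)) :
    U ≤ normalizer (centralizer (H : Set G) : Set G) := by
  refine le_normalizer_iff.2 fun u hu x hx y hy => ?_
  have hconj : u⁻¹ * y * u ∈ H := (mem_normalizer_iff''.1 (h hu) y).1 hy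
  simpa [mul_assoc] using congrArg (u * · * u⁻¹) (hx _ hconj)

theorem le_centralizer_of_inf_eq_bot (hHK : H ≤ normalizer (K : Set G))
    (hKH : K ≤ normalizer (H : Set G)) (h : H ⊓ K = ⊥) : H ≤ centralizer (K : Set G) := by
  rw [← commutator_eq_bot_iff_le_centralizer, ← le_bot_iff, ← h]
  exact le_inf (le_normalizer_iff_commutator_le_left.1 hKH)
    (le_normalizer_iff_commutator_le_right.1 hHK)

theorem coe_sup_of_le_centralizer (h : K ≤ centralizer (M : Set G)) :
    ((K ⊔ M : Subgroup G) : Set G) = (K : Set G) * (M : Set G) :=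
  coe_mul_of_left_le_normalizer_right K M (h.trans (centralizer_le_normalizer _))

theorem mem_sup_iff_of_le_centralizer (h : K ≤ centralizer (M : Set G)) {x : G} :
    x ∈ K ⊔ M ↔ ∃ k ∈ K, ∃ m ∈ M, k * m = x := by
  rw [← SetLike.mem_coe, coe_sup_of_le_centralizer h]
  exact Set.mem_mul

theorem sup_le_normalizer_left (h : K ≤ centralizer (M : Set G)) :
    K ⊔ M ≤ normalizer (K : Set G) :=
  sup_le le_normalizer ((le_centralizer_iff.1 h).trans (centralizer_le_normalizer _))

theorem centralizer_inf_sup (h : K ≤ centralizer (M : Set G))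
    (hK : K ⊓ centralizer (K : Set G) = ⊥) : centralizer (K : Set G) ⊓ (K ⊔ M) = M := by
  refine SetLike.coe_injective ?_
  rw [coe_inf, coe_sup_of_le_centralizer h, ← inf_mul_assoc _ _ _ (le_centralizer_iff.1 h),
    inf_comm, hK, coe_bot, Set.singleton_one, one_mul]

theorem commute_left_of_commute_mul (h : K ≤ centralizer (M : Set G)) (hKM : K ⊓ M = ⊥)
    {k k' m m' : G} (hk : k ∈ K) (hk' : k' ∈ K) (hm : m ∈ M) (hm' : m' ∈ M)
    (hc : Commute (k * m) (k' * m')) : Commute k (k' * m') := by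
  have hcomm : ∀ x ∈ K, ∀ y ∈ M, Commute x y := fun x hx y hy => (h hx y hy).symm
  have hmul : (k * k') * (m * m') = (k' * k) * (m' * m) := calc
    (k * k') * (m * m') = (k * m) * (k' * m') := (hcomm k' hk' m hm).mul_mul_mul_comm k m'
    _ = (k' * m') * (k * m) := hc
    _ = (k' * k) * (m' * m) := ((hcomm k hk m' hm').mul_mul_mul_comm k' m).symm
  have hpair := mul_injective_of_disjoint (disjoint_iff.2 hKM)
    (a₁ := (⟨k * k', mul_mem hk hk'⟩, ⟨m * m', mul_mem hm hm'⟩))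
    (a₂ := (⟨k' * k, mul_mem hk' hk⟩, ⟨m' * m, mul_mem hm' hm⟩)) hmul
  have hkk' : Commute k k' := congrArg Subtype.val (congrArg Prod.fst hpair)
  exact hkk'.mul_right (hcomm k hk m' hm')

end CommutingSubgroups

section LocalClass

variable {G : Type u} [Group G] [TopologicalSpace G]

theorem LocalClass.mk_mono {H K : Subgroup G} (h : H ≤ K) : LocalClass.mk H ≤ LocalClass.mk K :=
  ⟨⊤, inf_le_left.trans h⟩

theorem LocalClass.mk_le_mk {H K : Subgroup G} :
    LocalClass.mk H ≤ LocalClass.mk K ↔ ∃ U : OpenSubgroup G, H ⊓ (U : Subgroup G) ≤ K :=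
  Iff.rfl

theorem LocalClass.mk_inf_openSubgroup (H : Subgroup G) (U : OpenSubgroup G) :
    LocalClass.mk (H ⊓ (U : Subgroup G)) = LocalClass.mk H :=
  le_antisymm (mk_mono inf_le_left) ⟨U, le_rfl⟩

instance : OrderBot (LocalClass G) where
  bot := LocalClass.mk ⊥
  bot_le := by
    rintro ⟨H⟩
    exact LocalClass.mk_mono bot_le

instance : SemilatticeInf (LocalClass G) where
  inf := Quotient.map₂ (fun H K => H ⊓ K) (by
    rintro H H' ⟨U, hU⟩ K K' ⟨V, hV⟩
    refine ⟨U ⊓ V, ?_⟩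
    rw [OpenSubgroup.toSubgroup_inf, inf_inf_inf_comm, hU, hV, inf_inf_inf_comm])
  inf_le_left := by
    rintro ⟨H⟩ ⟨K⟩
    exact LocalClass.mk_mono inf_le_left
  inf_le_right := by
    rintro ⟨H⟩ ⟨K⟩
    exact LocalClass.mk_mono inf_le_right
  le_inf := by
    rintro ⟨L⟩ ⟨H⟩ ⟨K⟩ ⟨U, hU⟩ ⟨V, hV⟩
    refine ⟨U ⊓ V, ?_⟩
    rw [OpenSubgroup.toSubgroup_inf]
    exact le_inf ((inf_le_inf_left _ inf_le_left).trans hU)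
      ((inf_le_inf_left _ inf_le_right).trans hV)

theorem LocalClass.mk_inf_mk (H K : Subgroup G) :
    LocalClass.mk H ⊓ LocalClass.mk K = LocalClass.mk (H ⊓ K) :=
  rfl

theorem LocalClass.mk_eq_bot_iff {H : Subgroup G} :
    LocalClass.mk H = ⊥ ↔ ∃ V : OpenSubgroup G, H ⊓ (V : Subgroup G) = ⊥ := by
  simp only [← le_bot_iff]
  rfl

theorem quasiCentraliser_anti (L : Subgroup G) {H K : Subgroup G}
    (h : LocalClass.mk H ≤ LocalClass.mk K) : quasiCentraliser L K ≤ quasiCentraliser L H := by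
  obtain ⟨U, hU⟩ := h
  rintro x ⟨hx, V, hV⟩
  refine ⟨hx, U ⊓ V, Subgroup.centralizer_le (SetLike.coe_subset_coe.2 ?_) hV⟩
  rw [OpenSubgroup.toSubgroup_inf, ← inf_assoc]
  exact inf_le_inf_right _ hU

theorem LocalClass.perp_mk (H : Subgroup G) :
    (LocalClass.mk H).perp = LocalClass.mk (quasiCentraliser ⊤ H) :=
  rfl

theorem LocalClass.perp_anti {α β : LocalClass G} (h : α ≤ β) : β.perp ≤ α.perp := by
  induction α using Quotient.inductionOn
  induction β using Quotient.inductionOn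
  exact mk_mono (quasiCentraliser_anti ⊤ h)

theorem centralizer_le_quasiCentraliser (H : Subgroup G) (U : OpenSubgroup G) :
    Subgroup.centralizer ((H ⊓ (U : Subgroup G) : Subgroup G) : Set G) ≤ quasiCentraliser ⊤ H :=
  fun _ hx => ⟨trivial, U, hx⟩

end LocalClass

section Conjugation

variable {G : Type u} [Group G] [TopologicalSpace G] [ContinuousMul G]

theorem continuous_conj (g : G) : Continuous (MulAut.conj g) := by
  change Continuous fun x => g * x * g⁻¹
  fun_prop

theorem isOpen_map_conj (g : G) {U : Subgroup G} (hU : IsOpen (U : Set G)) :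
    IsOpen (U.map (MulAut.conj g).toMonoidHom : Set G) :=
  ((Homeomorph.mulRight g⁻¹).isOpenMap.comp (Homeomorph.mulLeft g).isOpenMap) _ hU

theorem LocalClass.conj_one (α : LocalClass G) : α.conj 1 = α := by
  induction α using Quotient.inductionOn with | _ H
  refine congrArg LocalClass.mk ?_
  rw [map_one]
  exact H.map_id

theorem LocalClass.conj_mul (g h : G) (α : LocalClass G) :
    α.conj (g * h) = (α.conj h).conj g := by
  induction α using Quotient.inductionOn with | _ H
  refine congrArg LocalClass.mk ?_
  rw [Subgroup.map_map, map_mul]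
  rfl

theorem LocalClass.conj_mono (g : G) {α β : LocalClass G} (h : α ≤ β) : α.conj g ≤ β.conj g := by
  induction α using Quotient.inductionOn with | _ H
  induction β using Quotient.inductionOn with | _ K
  obtain ⟨U, hU⟩ := h
  refine ⟨⟨_, isOpen_map_conj g U.isOpen⟩, ?_⟩
  rw [← Subgroup.map_inf _ _ _ (MulAut.conj g).injective]
  exact Subgroup.map_mono hU

/-- The action of `G` by conjugation on the poset of local classes. -/
def LocalClass.conjHom (G : Type u) [Group G] [TopologicalSpace G] [ContinuousMul G] :
    G →* (LocalClass G ≃o LocalClass G) where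
  toFun g :=
    { toFun := LocalClass.conj g
      invFun := LocalClass.conj g⁻¹
      left_inv := fun α => by rw [← conj_mul, inv_mul_cancel, conj_one]
      right_inv := fun α => by rw [← conj_mul, mul_inv_cancel, conj_one]
      map_rel_iff' := fun {α β} => by
        refine ⟨fun h => ?_, conj_mono g⟩
        have h' := conj_mono g⁻¹ h
        simpa only [Equiv.coe_fn_mk, ← conj_mul, inv_mul_cancel, conj_one] using h' }
  map_one' := by
    ext α
    exact conj_one α
  map_mul' g h := by
    ext α
    exact conj_mul g h α

theorem map_conj_quasiCentraliser_le (g : G) (H : Subgroup G) :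
    (quasiCentraliser ⊤ H).map (MulAut.conj g).toMonoidHom ≤
      quasiCentraliser ⊤ (H.map (MulAut.conj g).toMonoidHom) := by
  rintro _ ⟨x, ⟨-, U, hU⟩, rfl⟩
  refine ⟨trivial, ⟨_, isOpen_map_conj g U.isOpen⟩, ?_⟩
  rw [← Subgroup.map_inf _ _ _ (MulAut.conj g).injective]
  exact Subgroup.map_centralizer_le_centralizer_image _ _ ⟨x, hU, rfl⟩

theorem LocalClass.perp_conj (g : G) (α : LocalClass G) : (α.conj g).perp = α.perp.conj g := by
  have conj_perp_le : ∀ (g : G) (α : LocalClass G), α.perp.conj g ≤ (α.conj g).perp := by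
    intro g α
    induction α using Quotient.inductionOn with | _ H
    exact mk_mono (map_conj_quasiCentraliser_le g H)
  refine le_antisymm ?_ (conj_perp_le g α)
  have h := conj_mono g (conj_perp_le g⁻¹ (α.conj g))
  rwa [← conj_mul, ← conj_mul, mul_inv_cancel, inv_mul_cancel, conj_one, conj_one] at h

theorem LocalClass.conj_eq_self_of_le_mk_centralizer {α : LocalClass G} {x : G}
    (h : α ≤ LocalClass.mk (Subgroup.centralizer {x})) : α.conj x = α := by
  induction α using Quotient.inductionOn with | _ H
  obtain ⟨U, hU⟩ := h
  change (LocalClass.mk H).conj x = LocalClass.mk H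
  rw [← LocalClass.mk_inf_openSubgroup H U]
  refine congrArg LocalClass.mk (Subgroup.mem_normalizer_iff_map_conj_eq.1 ?_)
  exact Subgroup.centralizer_le_normalizer _ fun y hy =>
    (Subgroup.mem_centralizer_singleton_iff.1 (hU hy))

end Conjugation

section OpenSubgroups

variable {G : Type u} [Group G] [TopologicalSpace G] [IsTopologicalGroup G]

theorem isOpen_centralizer_singleton {F : Subgroup G} [DiscreteTopology F]
    (hF : IsOpen (Subgroup.normalizer (F : Set G) : Set G)) {x : G} (hx : x ∈ F) :
    IsOpen (Subgroup.centralizer {x} : Set G) := by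
  obtain ⟨W, hW, hWF⟩ := isOpen_induced_iff.1 (isOpen_discrete ({⟨x, hx⟩} : Set F))
  have hconj : (fun y => y * x * y⁻¹) ⁻¹' W ∈ nhds (1 : G) := by
    refine (by fun_prop : Continuous fun y : G => y * x * y⁻¹).continuousAt
      (hW.mem_nhds ?_)
    have hxW : (⟨x, hx⟩ : F) ∈ Subtype.val ⁻¹' W := hWF.ge rfl
    simpa using hxW
  refine Subgroup.isOpen_of_mem_nhds _ (g := 1) ?_
  filter_upwards [hconj, hF.mem_nhds (Subgroup.one_mem _)] with y hyW hyN
  have hyF : y * x * y⁻¹ ∈ F := (Subgroup.mem_normalizer_iff.1 hyN x).1 hx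
  have hyx : (⟨y * x * y⁻¹, hyF⟩ : F) ∈ ({⟨x, hx⟩} : Set F) := hWF.le hyW
  rw [SetLike.mem_coe, Subgroup.mem_centralizer_singleton_iff, ← mul_inv_eq_iff_eq_mul]
  exact congrArg Subtype.val hyx

theorem isOpen_of_isClosed_of_relIndex_ne_zero {L U : Subgroup G} (hU : IsOpen (U : Set G))
    (hL : IsClosed (L : Set G)) (hLU : L ≤ U) (hi : L.relIndex U ≠ 0) : IsOpen (L : Set G) := by
  have : (L.subgroupOf U).FiniteIndex := ⟨hi⟩
  have hLo : IsOpen (L.subgroupOf U : Set U) :=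
    Subgroup.isOpen_of_isClosed_of_finiteIndex _ (hL.preimage continuous_subtype_val)
  rw [← inf_eq_left.2 hLU, ← Subgroup.subgroupOf_map_subtype]
  exact hU.isOpenMap_subtype_val _ hLo

theorem exists_openSubgroup_le_le_normalizer {U : OpenSubgroup G} (hU : IsCompact (U : Set G))
    (V : OpenSubgroup G) : ∃ W : OpenSubgroup G, (W : Subgroup G) ≤ V ∧
      (U : Subgroup G) ≤ Subgroup.normalizer (W : Set G) := by
  have : CompactSpace (U : Subgroup G) := isCompact_iff_compactSpace.1 hU
  obtain ⟨N, hN⟩ := IsTopologicalGroup.exist_openNormalSubgroup_sub_clopen_nhds_of_one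
    (V.isClopen.preimage (continuous_subtype_val (p := (· ∈ (U : Subgroup G))))) V.one_mem
  refine ⟨⟨N.toSubgroup.map (U : Subgroup G).subtype, U.isOpen.isOpenMap_subtype_val _ N.isOpen⟩,
    Subgroup.map_le_iff_le_comap.2 hN, ?_⟩
  have hnormal : ((N.toSubgroup.map (U : Subgroup G).subtype).subgroupOf U).Normal := by
    rw [Subgroup.subgroupOf, Subgroup.comap_map_eq_self_of_injective (Subgroup.subtype_injective _)]
    exact N.isNormal'
  exact Subgroup.le_normalizer_of_normal_subgroupOf (Subgroup.map_subtype_le _)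

theorem isOpen_stabilizer_of_isOpen_of_isCompact {W : Set G} (hWo : IsOpen W) (hWc : IsCompact W) :
    IsOpen (MulAction.stabilizer G W : Set G) := by
  obtain ⟨T, hT, hTW⟩ := compact_open_separated_mul_left hWc hWo subset_rfl
  refine Subgroup.isOpen_of_mem_nhds _ (g := 1) ?_
  filter_upwards [hT, inv_mem_nhds_one G hT] with g hg hg'
  have smul_subset : ∀ t ∈ T, t • W ⊆ W := fun t ht =>
    (Set.smul_set_subset_mul ht).trans hTW
  exact (smul_subset g hg).antisymm (Set.subset_smul_set_iff.2 (smul_subset g⁻¹ hg'))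

theorem exists_isCompact_openSubgroup_subset [LocallyCompactSpace G] [TotallyDisconnectedSpace G]
    {s : Set G} (hs : s ∈ nhds 1) :
    ∃ U : OpenSubgroup G, IsCompact (U : Set G) ∧ (U : Set G) ⊆ s := by
  obtain ⟨C, hC, hCs, hCc⟩ := local_compact_nhds hs
  obtain ⟨W, hW, h1W, hWC⟩ := (loc_compact_Haus_tot_disc_of_zero_dim (H := G)).mem_nhds_iff.1 hC
  have hWcl : IsClopen W := hW
  have hWc : IsCompact W := hCc.of_isClosed_subset hWcl.isClosed hWC
  let U : OpenSubgroup G :=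
    ⟨MulAction.stabilizer G W, isOpen_stabilizer_of_isOpen_of_isCompact hWcl.isOpen hWc⟩
  have hUW : (U : Set G) ⊆ W := fun g (hg : g • W = W) => by
    simpa [hg] using Set.smul_mem_smul_set (a := g) h1W
  exact ⟨U, hWc.of_isClosed_subset U.isClosed hUW, hUW.trans (hWC.trans hCs)⟩

end OpenSubgroups

section LocallyNormal

variable {G : Type u} [Group G] [TopologicalSpace G]

theorem TrivialQuasiCentre.eq_bot_of_discreteTopology [IsTopologicalGroup G]
    (hG : TrivialQuasiCentre G) {F : Subgroup G} [DiscreteTopology F]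
    (hF : IsOpen (Subgroup.normalizer (F : Set G) : Set G)) : F = ⊥ :=
  F.eq_bot_iff_forall.2 fun x hx => hG x (isOpen_centralizer_singleton hF hx)

theorem TrivialQuasiCentre.mk_eq_bot_iff [IsTopologicalGroup G] (hG : TrivialQuasiCentre G)
    {H : Subgroup G} (hH : IsOpen (Subgroup.normalizer (H : Set G) : Set G)) :
    LocalClass.mk H = ⊥ ↔ H = ⊥ := by
  refine ⟨fun h => ?_, fun h => congrArg LocalClass.mk h⟩
  obtain ⟨V, hV⟩ := LocalClass.mk_eq_bot_iff.1 h
  have : DiscreteTopology H := by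
    refine discreteTopology_of_isOpen_singleton_one ?_
    convert V.isOpen.preimage (continuous_subtype_val (p := (· ∈ H))) using 1
    ext x
    have hx : (x : G) ∈ V ↔ (x : G) ∈ H ⊓ (V : Subgroup G) := ⟨fun h => ⟨x.2, h⟩, fun h => h.2⟩
    rw [Set.mem_preimage, SetLike.mem_coe, hx, hV, Subgroup.mem_bot, Set.mem_singleton_iff,
      OneMemClass.coe_eq_one]
  exact hG.eq_bot_of_discreteTopology hH

theorem IsLocallyNormal.inf [T2Space G] [SeparatelyContinuousMul G] {H K : Subgroup G}
    (hH : IsLocallyNormal H) (hK : IsLocallyNormal K) : IsLocallyNormal (H ⊓ K) :=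
  ⟨hH.1.inter hK.1,
    Subgroup.isOpen_mono Subgroup.inf_normalizer_le_normalizer_inf (hH.2.inter hK.2)⟩

theorem isLocallyNormal_bot : IsLocallyNormal (⊥ : Subgroup G) := by
  refine ⟨?_, ?_⟩
  · rw [Subgroup.coe_bot]
    exact isCompact_singleton
  · rw [Subgroup.normalizer_eq_top]
    exact isOpen_univ

theorem IsLocallyNormal.map_conj [ContinuousMul G] {H : Subgroup G} (hH : IsLocallyNormal H)
    (g : G) : IsLocallyNormal (H.map (MulAut.conj g).toMonoidHom) := by
  refine ⟨hH.1.image (continuous_conj g), ?_⟩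
  rw [← Subgroup.map_equiv_normalizer_eq]
  exact isOpen_map_conj g hH.2

theorem bot_mem_structureLattice : ⊥ ∈ structureLattice G :=
  ⟨⊥, isLocallyNormal_bot, rfl⟩

theorem inf_mem_structureLattice [T2Space G] [SeparatelyContinuousMul G] {α β : LocalClass G}
    (hα : α ∈ structureLattice G) (hβ : β ∈ structureLattice G) : α ⊓ β ∈ structureLattice G := by
  obtain ⟨H, hH, rfl⟩ := hα
  obtain ⟨K, hK, rfl⟩ := hβ
  exact ⟨H ⊓ K, hH.inf hK, rfl⟩

theorem conj_mem_structureLattice [ContinuousMul G] {α : LocalClass G}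
    (hα : α ∈ structureLattice G) (g : G) : α.conj g ∈ structureLattice G := by
  obtain ⟨H, hH, rfl⟩ := hα
  exact ⟨_, hH.map_conj g, rfl⟩

end LocallyNormal

section CStable

open Subgroup

variable {G : Type u} [Group G] [TopologicalSpace G] [IsTopologicalGroup G]

theorem IsLocallyCStable.inf_centralizer_eq_bot (hG : IsLocallyCStable G) {H : Subgroup G}
    (hH : IsLocallyNormal H) : H ⊓ centralizer (H : Set G) = ⊥ := by
  have hle : H ⊓ centralizer (H : Set G) ≤
      quasiCentraliser ⊤ H ⊓ quasiCentraliser ⊤ (centralizer (H : Set G)) :=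
    le_inf (fun x hx => ⟨trivial, ⊤, centralizer_le inf_le_left hx.2⟩)
      (fun x hx => ⟨trivial, ⊤, centralizer_le inf_le_left
        (le_centralizer_iff.1 le_rfl hx.1)⟩)
  have : DiscreteTopology ↥(H ⊓ centralizer (H : Set G)) :=
    DiscreteTopology.of_subset (hG.2 H hH).1 hle
  exact hG.1.eq_bot_of_discreteTopology
    (isOpen_mono (le_normalizer_inf le_rfl (le_normalizer_centralizer le_rfl)) hH.2)

theorem IsLocallyCStable.quasiCentraliser_inf_le (hG : IsLocallyCStable G)
    {H : Subgroup G} (hH : IsCompact (H : Set G)) {U : OpenSubgroup G} (hU : IsCompact (U : Set G))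
    (hHU : (U : Subgroup G) ≤ normalizer (H : Set G)) :
    quasiCentraliser ⊤ H ⊓ U ≤ centralizer ((H ⊓ (U : Subgroup G) : Subgroup G) : Set G) := by
  rintro x ⟨⟨-, V, hV⟩, hxU⟩
  obtain ⟨W, hWV, hUW⟩ := exists_openSubgroup_le_le_normalizer hU V
  have hHW : (U : Subgroup G) ≤ normalizer ((H ⊓ (W : Subgroup G) : Subgroup G) : Set G) :=
    le_normalizer_inf hHU hUW
  set C := centralizer ((H ⊓ (W : Subgroup G) : Subgroup G) : Set G) ⊓ (U : Subgroup G)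
  have hC : (U : Subgroup G) ≤ normalizer (C : Set G) :=
    le_normalizer_inf (le_normalizer_centralizer hHW) le_normalizer
  have hHUU : (U : Subgroup G) ≤ normalizer ((H ⊓ (U : Subgroup G) : Subgroup G) : Set G) :=
    le_normalizer_inf hHU le_normalizer
  have hbot : C ⊓ (H ⊓ (U : Subgroup G)) = ⊥ := by
    rw [← hG.1.mk_eq_bot_iff (isOpen_mono (le_normalizer_inf hC hHUU) U.isOpen),
      LocalClass.mk_eq_bot_iff]
    have hZ := hG.inf_centralizer_eq_bot
      ⟨hH.inter_right W.isClosed, isOpen_mono hHW U.isOpen⟩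
    exact ⟨W, le_bot_iff.1 fun y hy => hZ.le ⟨⟨hy.1.2.1, hy.2⟩, hy.1.1.1⟩⟩
  exact le_centralizer_of_inf_eq_bot (inf_le_right.trans hHUU) (inf_le_right.trans hC) hbot
    ⟨centralizer_le (SetLike.coe_subset_coe.2 (inf_le_inf_left H hWV)) hV, hxU⟩

theorem IsLocallyCStable.perp_mk (hG : IsLocallyCStable G) {H : Subgroup G}
    (hH : IsCompact (H : Set G)) {U : OpenSubgroup G} (hU : IsCompact (U : Set G))
    (hHU : (U : Subgroup G) ≤ normalizer (H : Set G)) : (LocalClass.mk H).perp =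
      LocalClass.mk (centralizer ((H ⊓ (U : Subgroup G) : Subgroup G) : Set G) ⊓ U) := by
  rw [LocalClass.perp_mk]
  exact le_antisymm
    (LocalClass.mk_le_mk.2 ⟨U, le_inf (hG.quasiCentraliser_inf_le hH hU hHU) inf_le_right⟩)
    (LocalClass.mk_mono (inf_le_left.trans (centralizer_le_quasiCentraliser H U)))

variable [LocallyCompactSpace G] [TotallyDisconnectedSpace G]

theorem IsLocallyNormal.exists_isCompact_openSubgroup {H : Subgroup G} (hH : IsLocallyNormal H) :
    ∃ U : OpenSubgroup G, IsCompact (U : Set G) ∧ (U : Subgroup G) ≤ normalizer (H : Set G) :=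
  exists_isCompact_openSubgroup_subset (hH.2.mem_nhds (one_mem _))

theorem IsLocallyCStable.perp_mem_structureLattice (hG : IsLocallyCStable G) {α : LocalClass G}
    (hα : α ∈ structureLattice G) : α.perp ∈ structureLattice G := by
  obtain ⟨H, hH, rfl⟩ := hα
  obtain ⟨U, hU, hHU⟩ := hH.exists_isCompact_openSubgroup
  refine ⟨_, ⟨hU.inter_left (Set.isClosed_centralizer _), isOpen_mono ?_ U.isOpen⟩,
    (hG.perp_mk hH.1 hU hHU).symm⟩
  exact le_normalizer_inf (le_normalizer_centralizer (le_normalizer_inf hHU le_normalizer))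
    le_normalizer

theorem IsLocallyCStable.inf_perp_eq_bot (hG : IsLocallyCStable G) {α : LocalClass G}
    (hα : α ∈ structureLattice G) : α ⊓ α.perp = ⊥ := by
  obtain ⟨H, hH, rfl⟩ := hα
  obtain ⟨U, hU, hHU⟩ := hH.exists_isCompact_openSubgroup
  have hZ := hG.inf_centralizer_eq_bot
    ⟨hH.1.inter_right U.isClosed, isOpen_mono (le_normalizer_inf hHU le_normalizer) U.isOpen⟩
  rw [hG.perp_mk hH.1 hU hHU, ← LocalClass.mk_inf_openSubgroup H U, LocalClass.mk_inf_mk,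
    ← inf_assoc, hZ, bot_inf_eq]
  rfl

theorem IsLocallyCStable.inf_eq_bot_iff (hG : IsLocallyCStable G) {α β : LocalClass G}
    (hα : α ∈ structureLattice G) (hβ : β ∈ structureLattice G) :
    α ⊓ β = ⊥ ↔ α ≤ β.perp := by
  refine ⟨fun h => ?_, fun h => le_bot_iff.1 ?_⟩
  · obtain ⟨H, hH, rfl⟩ := hα
    obtain ⟨K, hK, rfl⟩ := hβ
    let U : OpenSubgroup G := ⟨_, hH.2⟩ ⊓ ⟨_, hK.2⟩
    have hHU : (U : Subgroup G) ≤ normalizer (H : Set G) := inf_le_left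
    have hKU : (U : Subgroup G) ≤ normalizer (K : Set G) := inf_le_right
    have hHK : H ⊓ K = ⊥ := (hG.1.mk_eq_bot_iff (hH.inf hK).2).1 h
    rw [← LocalClass.mk_inf_openSubgroup H U]
    refine LocalClass.mk_mono (.trans ?_ (centralizer_le_quasiCentraliser K U))
    refine le_centralizer_of_inf_eq_bot
      (inf_le_right.trans (le_normalizer_inf hKU le_normalizer))
      (inf_le_right.trans (le_normalizer_inf hHU le_normalizer)) ?_
    rw [← inf_inf_distrib_right, hHK, bot_inf_eq]
  · rw [← hG.inf_perp_eq_bot hβ, inf_comm]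
    exact inf_le_inf_left β h

theorem IsLocallyCStable.le_perp_perp (hG : IsLocallyCStable G) {α : LocalClass G}
    (hα : α ∈ structureLattice G) : α ≤ α.perp.perp := by
  rw [← hG.inf_eq_bot_iff hα (hG.perp_mem_structureLattice hα)]
  exact hG.inf_perp_eq_bot hα

theorem IsLocallyCStable.perp_perp_perp (hG : IsLocallyCStable G) {α : LocalClass G}
    (hα : α ∈ structureLattice G) : α.perp.perp.perp = α.perp :=
  le_antisymm (LocalClass.perp_anti (hG.le_perp_perp hα))
    (hG.le_perp_perp (hG.perp_mem_structureLattice hα))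

end CStable

section OpenMapping

open Subgroup

variable {G : Type u} [Group G] [TopologicalSpace G] [IsTopologicalGroup G]
  [LocallyCompactSpace G] [T2Space G]

theorem isOpen_inter_mul_inter_of_isOpen_sup {K M : Subgroup G} [SigmaCompactSpace K]
    [SigmaCompactSpace M] (h : K ≤ centralizer (M : Set G))
    (ho : IsOpen ((K ⊔ M : Subgroup G) : Set G)) {W : Set G} (hW : IsOpen W) :
    IsOpen (((K : Set G) ∩ W) * ((M : Set G) ∩ W)) := by
  let f : K × M →* G := K.subtype.noncommCoprod M.subtype fun k m => (h k.2 m m.2).symm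
  have hrange : f.range = K ⊔ M := by
    simpa only [range_subtype] using
      MonoidHom.noncommCoprod_range (f := K.subtype) (g := M.subtype)
        (comm := fun k m => (h k.2 m m.2).symm)
  have hf : Continuous f := (by fun_prop : Continuous fun p : K × M => (p.1 : G) * (p.2 : G))
  have hfo : IsOpen (f.range : Set G) := by rwa [hrange]
  have : LocallyCompactSpace f.range := hfo.locallyCompactSpace
  have hopen : IsOpenMap f := hfo.isOpenMap_subtype_val.comp
    (MonoidHom.isOpenMap_of_sigmaCompact f.rangeRestrict f.rangeRestrict_surjective
      (hf.subtype_mk _))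
  convert hopen _ ((hW.preimage continuous_subtype_val).prod
    (hW.preimage continuous_subtype_val)) using 1
  ext x
  constructor
  · rintro ⟨k, ⟨hk, hkW⟩, m, ⟨hm, hmW⟩, rfl⟩
    exact ⟨(⟨k, hk⟩, ⟨m, hm⟩), ⟨hkW, hmW⟩, rfl⟩
  · rintro ⟨⟨k, m⟩, ⟨hkW, hmW⟩, rfl⟩
    exact ⟨k, ⟨k.2, hkW⟩, m, ⟨m.2, hmW⟩, rfl⟩

end OpenMapping

/-- Two commuting compact subgroups `K`, `M` with open product, whose local classes are
complementary elements of `LD(G)`. That `K` and `M` meet trivially is not part of the definition: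
in a locally C-stable group it follows. -/
structure IsOpenFactorPair {G : Type u} [Group G] [TopologicalSpace G] (K M : Subgroup G) :
    Prop where
  isCompact_left : IsCompact (K : Set G)
  isCompact_right : IsCompact (M : Set G)
  le_centralizer : K ≤ Subgroup.centralizer (M : Set G)
  isOpen : IsOpen ((K ⊔ M : Subgroup G) : Set G)

namespace IsOpenFactorPair

open Subgroup

variable {G : Type u} [Group G] [TopologicalSpace G] {K M K' M' : Subgroup G}

theorem symm (h : IsOpenFactorPair K M) : IsOpenFactorPair M K :=
  ⟨h.isCompact_right, h.isCompact_left, le_centralizer_iff.1 h.le_centralizer,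
    sup_comm K M ▸ h.isOpen⟩

theorem isCompact_sup [ContinuousMul G] (h : IsOpenFactorPair K M) :
    IsCompact ((K ⊔ M : Subgroup G) : Set G) := by
  rw [coe_sup_of_le_centralizer h.le_centralizer]
  exact h.isCompact_left.mul h.isCompact_right

theorem isLocallyNormal_left [ContinuousMul G] (h : IsOpenFactorPair K M) : IsLocallyNormal K :=
  ⟨h.isCompact_left, isOpen_mono (sup_le_normalizer_left h.le_centralizer) h.isOpen⟩

theorem map_conj [ContinuousMul G] (h : IsOpenFactorPair K M) (g : G) :
    IsOpenFactorPair (K.map (MulAut.conj g).toMonoidHom) (M.map (MulAut.conj g).toMonoidHom) where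
  isCompact_left := h.isCompact_left.image (continuous_conj g)
  isCompact_right := h.isCompact_right.image (continuous_conj g)
  le_centralizer := (map_mono h.le_centralizer).trans (map_centralizer_le_centralizer_image _ _)
  isOpen := by
    rw [← Subgroup.map_sup]
    exact isOpen_map_conj g h.isOpen

variable [IsTopologicalGroup G]

theorem inf_eq_bot (hG : IsLocallyCStable G) (h : IsOpenFactorPair K M) : K ⊓ M = ⊥ :=
  le_bot_iff.1 ((inf_le_inf_left K (le_centralizer_iff.1 h.le_centralizer)).trans_eq
    (hG.inf_centralizer_eq_bot h.isLocallyNormal_left))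

theorem quasiCentraliser_inf_sup (hG : IsLocallyCStable G) (h : IsOpenFactorPair K M) :
    quasiCentraliser ⊤ K ⊓ (K ⊔ M) = M := by
  refine le_antisymm ?_ (le_inf (fun m hm => ⟨trivial, ⊤, ?_⟩) le_sup_right)
  · have hQC := hG.quasiCentraliser_inf_le (U := ⟨K ⊔ M, h.isOpen⟩) h.isCompact_left h.isCompact_sup
      (sup_le_normalizer_left h.le_centralizer)
    rw [inf_eq_left.2 (le_sup_left : K ≤ K ⊔ M)] at hQC
    exact (le_inf hQC inf_le_right).trans_eq (centralizer_inf_sup h.le_centralizer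
      (hG.inf_centralizer_eq_bot h.isLocallyNormal_left))
  · exact centralizer_le inf_le_left (le_centralizer_iff.1 h.le_centralizer hm)

theorem perp_mk (hG : IsLocallyCStable G) (h : IsOpenFactorPair K M) :
    (LocalClass.mk K).perp = LocalClass.mk M := by
  rw [LocalClass.perp_mk, ← LocalClass.mk_inf_openSubgroup _ ⟨K ⊔ M, h.isOpen⟩]
  exact congrArg LocalClass.mk (h.quasiCentraliser_inf_sup hG)

/-- The projection `k` of `c = k m ∈ K'` to `K` centralises `M' ∩ (K × M)`, hence lies in `K'`. -/
theorem inf_sup_le (hG : IsLocallyCStable G) (h : IsOpenFactorPair K M)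
    (h' : IsOpenFactorPair K' M') (hle : K ⊔ M ≤ K' ⊔ M') :
    K' ⊓ (K ⊔ M) ≤ (K' ⊓ K) ⊔ (K' ⊓ M) := by
  rintro c ⟨hcK', hc⟩
  obtain ⟨k, hk, m, hm, rfl⟩ := (mem_sup_iff_of_le_centralizer h.le_centralizer).1 hc
  have hkM' : k ∈ quasiCentraliser ⊤ M' := by
    refine ⟨trivial, ⟨K ⊔ M, h.isOpen⟩, fun y hy => ?_⟩
    obtain ⟨k₁, hk₁, m₁, hm₁, rfl⟩ := (mem_sup_iff_of_le_centralizer h.le_centralizer).1 hy.2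
    exact (commute_left_of_commute_mul h.le_centralizer (h.inf_eq_bot hG) hk hk₁ hm hm₁
      (h'.le_centralizer hcK' _ hy.1).symm).symm
  have hkK' : k ∈ K' := by
    rw [← h'.symm.quasiCentraliser_inf_sup hG, sup_comm M' K']
    exact ⟨hkM', hle (mem_sup_left hk)⟩
  exact mul_mem (mem_sup_left ⟨hkK', hk⟩)
    (mem_sup_right ⟨(mul_mem_cancel_left hkK').1 hcK', hm⟩)

variable [LocallyCompactSpace G] [T2Space G]

theorem inf_openSubgroup (h : IsOpenFactorPair K M) (U : OpenSubgroup G) :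
    IsOpenFactorPair (K ⊓ (U : Subgroup G)) (M ⊓ (U : Subgroup G)) where
  isCompact_left := h.isCompact_left.inter_right U.isClosed
  isCompact_right := h.isCompact_right.inter_right U.isClosed
  le_centralizer := inf_le_left.trans (h.le_centralizer.trans (centralizer_le inf_le_left))
  isOpen := by
    have : CompactSpace K := isCompact_iff_compactSpace.1 h.isCompact_left
    have : CompactSpace M := isCompact_iff_compactSpace.1 h.isCompact_right
    rw [coe_sup_of_le_centralizer
      (inf_le_left.trans (h.le_centralizer.trans (centralizer_le inf_le_left)))]
    exact isOpen_inter_mul_inter_of_isOpen_sup h.le_centralizer h.isOpen U.isOpen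

theorem inf (hG : IsLocallyCStable G) (h : IsOpenFactorPair K M) (h' : IsOpenFactorPair K' M')
    (hle : K ⊔ M ≤ K' ⊔ M') : IsOpenFactorPair (K ⊓ K') ((K ⊓ M') ⊔ M) where
  isCompact_left := h.isCompact_left.inter h'.isCompact_left
  isCompact_right := by
    rw [coe_sup_of_le_centralizer (inf_le_left.trans h.le_centralizer)]
    exact (h.isCompact_left.inter h'.isCompact_right).mul h.isCompact_right
  le_centralizer := by
    rw [le_centralizer_iff]
    exact sup_le
      (inf_le_right.trans (h'.symm.le_centralizer.trans (centralizer_le inf_le_right)))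
      (h.symm.le_centralizer.trans (centralizer_le inf_le_left))
  isOpen := by
    have hK'M : K' ⊓ M ≤ (K ⊓ M') ⊔ M := inf_le_right.trans le_sup_right
    have hM'M : M' ⊓ M ≤ (K ⊓ M') ⊔ M := inf_le_right.trans le_sup_right
    have hM'K : M' ⊓ K ≤ (K ⊓ M') ⊔ M := (inf_comm M' K).le.trans le_sup_left
    refine isOpen_mono (sup_le ?_ ?_) (h'.inf_openSubgroup ⟨K ⊔ M, h.isOpen⟩).isOpen
    · exact (h.inf_sup_le hG h' hle).trans (sup_le_sup (inf_comm K' K).le hK'M)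
    · exact (h.inf_sup_le hG h'.symm (sup_comm K' M' ▸ hle)).trans
        ((sup_le hM'K hM'M).trans le_sup_right)

end IsOpenFactorPair

/-- The local classes of the factors of open internal direct products of compact subgroups. In a
locally C-stable group these are the elements of `LD(G)`. -/
def decompositionClasses (G : Type u) [Group G] [TopologicalSpace G] : Set (LocalClass G) :=
  {γ | ∃ K M : Subgroup G, IsOpenFactorPair K M ∧ LocalClass.mk K = γ}

section DecompositionClasses

open Subgroup

variable {G : Type u} [Group G] [TopologicalSpace G]

theorem conj_mem_decompositionClasses [ContinuousMul G] {α : LocalClass G}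
    (hα : α ∈ decompositionClasses G) (g : G) : α.conj g ∈ decompositionClasses G := by
  obtain ⟨K, M, h, rfl⟩ := hα
  exact ⟨_, _, h.map_conj g, rfl⟩

variable [IsTopologicalGroup G]

theorem bot_mem_decompositionClasses [LocallyCompactSpace G] [TotallyDisconnectedSpace G] :
    ⊥ ∈ decompositionClasses G := by
  obtain ⟨U, hU, -⟩ := exists_isCompact_openSubgroup_subset (G := G) Filter.univ_mem
  refine ⟨⊥, U, ⟨?_, hU, bot_le, ?_⟩, rfl⟩
  · rw [coe_bot]
    exact isCompact_singleton
  · rw [bot_sup_eq]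
    exact U.isOpen

theorem IsLocallyCStable.perp_mem_decompositionClasses (hG : IsLocallyCStable G)
    {α : LocalClass G} (hα : α ∈ decompositionClasses G) : α.perp ∈ decompositionClasses G := by
  obtain ⟨K, M, h, rfl⟩ := hα
  exact ⟨M, K, h.symm, (h.perp_mk hG).symm⟩

theorem IsLocallyCStable.perp_perp_of_mem_decompositionClasses (hG : IsLocallyCStable G)
    {α : LocalClass G} (hα : α ∈ decompositionClasses G) : α.perp.perp = α := by
  obtain ⟨K, M, h, rfl⟩ := hα
  rw [h.perp_mk hG, h.symm.perp_mk hG]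

variable [T2Space G]

theorem IsLocallyCStable.inf_mem_decompositionClasses [LocallyCompactSpace G]
    (hG : IsLocallyCStable G) {α β : LocalClass G} (hα : α ∈ decompositionClasses G)
    (hβ : β ∈ decompositionClasses G) : α ⊓ β ∈ decompositionClasses G := by
  obtain ⟨K, M, h, rfl⟩ := hα
  obtain ⟨K', M', h', rfl⟩ := hβ
  let U : OpenSubgroup G := ⟨K' ⊔ M', h'.isOpen⟩
  refine ⟨_, _, (h.inf_openSubgroup U).inf hG h' (sup_le inf_le_right inf_le_right), ?_⟩
  rw [← LocalClass.mk_inf_mk, LocalClass.mk_inf_openSubgroup]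

theorem IsLocallyCStable.isOpenFactorPair_of_isDirectFactor (hG : IsLocallyCStable G)
    {K L : Subgroup G} (hK : IsLocallyNormal K) (hLc : IsCompact (L : Set G))
    (hLo : IsOpen (L : Set G)) (hKL : IsDirectFactor K L) :
    ∃ M : Subgroup G, IsOpenFactorPair K M := by
  obtain ⟨M, hcomm, -, rfl⟩ := hKL
  have hKM : K ≤ centralizer (M : Set G) := fun k hk m hm => (hcomm k hk m hm).symm
  refine ⟨M, hK.1, ?_, hKM, hLo⟩
  rw [← centralizer_inf_sup hKM (hG.inf_centralizer_eq_bot hK)]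
  exact hLc.inter_left (Set.isClosed_centralizer _)

theorem IsLocallyCStable.range_decompositionLattice_cls (hG : IsLocallyCStable G) :
    Set.range (DecompositionLattice.cls (G := G)) = decompositionClasses G := by
  refine Subtype.range_coe.trans (Set.Subset.antisymm ?_ ?_)
  · rintro _ ⟨K, U, hK, hUo, hUc, ⟨L, hLU, hL, hi, hKL⟩, rfl⟩
    obtain ⟨M, h⟩ := hG.isOpenFactorPair_of_isDirectFactor hK (hUc.of_isClosed_subset hL hLU)
      (isOpen_of_isClosed_of_relIndex_ne_zero hUo hL hLU hi) hKL
    exact ⟨K, M, h, rfl⟩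
  · rintro _ ⟨K, M, h, rfl⟩
    refine ⟨K, K ⊔ M, h.isLocallyNormal_left, h.isOpen, h.isCompact_sup, ⟨K ⊔ M, le_rfl,
      isClosed_of_isOpen _ h.isOpen, ?_, M, fun k hk m hm => (h.le_centralizer hk m hm).symm,
      h.inf_eq_bot hG, rfl⟩, rfl⟩
    rw [relIndex_self]
    exact one_ne_zero

end DecompositionClasses

section BooleanAlgebras

/-- A meet-semilattice with an involutive pseudocomplementation `c` is a Boolean algebra with
complementation `c`. -/
abbrev booleanAlgebraOfInfEqBotIff {C : Type u} [SemilatticeInf C] [OrderBot C] (c : C → C)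
    (hcc : Function.Involutive c) (h : ∀ a b, a ⊓ b = ⊥ ↔ a ≤ c b) : BooleanAlgebra C :=
  have antitone_c : Antitone c := fun a b hab => by
    rw [← h, ← le_bot_iff, ← (h (c b) b).2 le_rfl]
    exact inf_le_inf_left _ hab
  have le_c_comm : ∀ {a b : C}, a ≤ c b → b ≤ c a := fun hab => by
    simpa only [hcc _] using antitone_c hab
  have le_top : ∀ a, a ≤ c ⊥ := fun a => (h a ⊥).1 (inf_bot_eq a)
  letI : HeytingAlgebra C :=
    { (inferInstance : SemilatticeInf C), (inferInstance : OrderBot C) with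
      sup a b := c (c a ⊓ c b)
      le_sup_left a b := le_c_comm inf_le_left
      le_sup_right a b := le_c_comm inf_le_right
      sup_le a b d hac hbc := by
        have h' := antitone_c (le_inf (antitone_c hac) (antitone_c hbc))
        rwa [hcc] at h'
      top := c ⊥
      le_top := le_top
      himp a b := c (a ⊓ c b)
      le_himp_iff a b d := by rw [← h, ← inf_assoc, h, hcc]
      compl := c
      himp_bot a := congrArg c (inf_eq_left.2 (le_top a)) }
  BooleanAlgebra.ofRegular fun a => hcc (a ⊔ aᶜ)

theorem exists_booleanAlgebra_of_range {P : Type u} [SemilatticeInf P] [OrderBot P] {c : P → P}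
    {C : Type v} {f : C → P} (hf : Function.Injective f) (hbot : ⊥ ∈ Set.range f)
    (hinf : ∀ a b, f a ⊓ f b ∈ Set.range f) (hc : ∀ a, c (f a) ∈ Set.range f)
    (hcc : ∀ a, c (c (f a)) = f a) (h : ∀ a b, f a ⊓ f b = ⊥ ↔ f a ≤ c (f b)) :
    ∃ _ : BooleanAlgebra C, (∀ a b, a ≤ b ↔ f a ≤ f b) ∧ ∀ a, f aᶜ = c (f a) := by
  obtain ⟨bot, hbot⟩ := hbot
  choose inf hinf using hinf
  choose compl hcompl using hc
  let : SemilatticeInf C :=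
    { PartialOrder.lift f hf with
      inf := inf
      inf_le_left a b := (hinf a b).trans_le inf_le_left
      inf_le_right a b := (hinf a b).trans_le inf_le_right
      le_inf a b d hab had := (le_inf hab had).trans_eq (hinf b d).symm }
  let : OrderBot C := { bot, bot_le a := hbot.trans_le bot_le }
  have inf_eq_bot_iff : ∀ a b : C, a ⊓ b = ⊥ ↔ a ≤ compl b := fun a b => by
    rw [← hf.eq_iff, show f (a ⊓ b) = f a ⊓ f b from hinf a b, show f ⊥ = ⊥ from hbot, h, ← hcompl]
    rfl
  exact ⟨booleanAlgebraOfInfEqBotIff compl (fun a => hf (by rw [hcompl, hcompl, hcc]))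
    inf_eq_bot_iff, fun a b => Iff.rfl, hcompl⟩

theorem exists_monoidHom_of_map_mem_range {G : Type*} [Group G] {P : Type u} [Preorder P]
    {C : Type v} [PartialOrder C] (f : C ↪o P) (φ : G →* (P ≃o P))
    (hφ : ∀ g a, φ g (f a) ∈ Set.range f) : ∃ τ : G →* (C ≃o C), ∀ g a, f (τ g a) = φ g (f a) := by
  choose t ht using hφ
  have t_mul : ∀ g h a, t (g * h) a = t g (t h a) := fun g h a => f.injective (by
    rw [ht, ht, ht, map_mul, RelIso.mul_apply])
  have t_one : ∀ a, t 1 a = a := fun a => f.injective (by rw [ht, map_one, RelIso.one_apply])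
  let e : G → (C ≃o C) := fun g =>
    { toFun := t g
      invFun := t g⁻¹
      left_inv := fun a => by rw [← t_mul, inv_mul_cancel, t_one]
      right_inv := fun a => by rw [← t_mul, mul_inv_cancel, t_one]
      map_rel_iff' := fun {a b} => by
        rw [Equiv.coe_fn_mk, ← f.le_iff_le, ht, ht, (φ g).le_iff_le, f.le_iff_le] }
  exact ⟨⟨⟨e, RelIso.ext t_one⟩, fun g h => RelIso.ext (t_mul g h)⟩, ht⟩

end BooleanAlgebras

section BooleanFamilies

/-- A set of locally normal classes that is, in a locally C-stable group, a Boolean algebra with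
complementation `⊥` on which `G` acts by conjugation. -/
structure IsBooleanFamily {G : Type u} [Group G] [TopologicalSpace G] [ContinuousMul G]
    (S : Set (LocalClass G)) : Prop where
  subset_structureLattice : S ⊆ structureLattice G
  bot_mem : ⊥ ∈ S
  inf_mem : ∀ α ∈ S, ∀ β ∈ S, α ⊓ β ∈ S
  perp_mem : ∀ α ∈ S, α.perp ∈ S
  perp_perp : ∀ α ∈ S, α.perp.perp = α
  conj_mem : ∀ g : G, ∀ α ∈ S, α.conj g ∈ S

/-- The action `τ` on a Boolean algebra is the conjugation action on local classes, under the
identification `cls` of the elements of the algebra with local classes. -/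
structure IsLocalClassAction {G : Type u} [Group G] [TopologicalSpace G] [ContinuousMul G]
    {M : Type v} [BooleanAlgebra M] (τ : G →* (M ≃o M)) (cls : M → LocalClass G) : Prop where
  le_iff : ∀ α β, α ≤ β ↔ cls α ≤ cls β
  cls_compl : ∀ α, cls αᶜ = (cls α).perp
  cls_map : ∀ g α, cls (τ g α) = (cls α).conj g

theorem IsLocalClassAction.injective {G : Type u} [Group G] [TopologicalSpace G] [ContinuousMul G]
    {M : Type v} [BooleanAlgebra M] {τ : G →* (M ≃o M)} {cls : M → LocalClass G}
    (h : IsLocalClassAction τ cls) : Function.Injective cls :=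
  fun _ _ hab => le_antisymm ((h.le_iff _ _).2 hab.le) ((h.le_iff _ _).2 hab.ge)

variable {G : Type u} [Group G] [TopologicalSpace G] [IsTopologicalGroup G]
  [LocallyCompactSpace G] [TotallyDisconnectedSpace G]

theorem IsBooleanFamily.exists_isLocalClassAction {S : Set (LocalClass G)} (hS : IsBooleanFamily S)
    (hG : IsLocallyCStable G) {C : Type v} {cls : C → LocalClass G}
    (hcls : Function.Injective cls) (hrange : Set.range cls = S) :
    ∃ (_ : BooleanAlgebra C) (τ : G →* (C ≃o C)), IsLocalClassAction τ cls := by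
  subst hrange
  have hSL : ∀ a, cls a ∈ structureLattice G := fun a => hS.subset_structureLattice ⟨a, rfl⟩
  obtain ⟨_, hle, hcompl⟩ := exists_booleanAlgebra_of_range hcls hS.bot_mem
    (fun a b => hS.inf_mem _ ⟨a, rfl⟩ _ ⟨b, rfl⟩) (fun a => hS.perp_mem _ ⟨a, rfl⟩)
    (fun a => hS.perp_perp _ ⟨a, rfl⟩) (fun a b => hG.inf_eq_bot_iff (hSL a) (hSL b))
  obtain ⟨τ, hτ⟩ := exists_monoidHom_of_map_mem_range
    (OrderEmbedding.ofMapLEIff cls fun a b => (hle a b).symm) (LocalClass.conjHom G)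
    fun g a => hS.conj_mem g _ ⟨a, rfl⟩
  exact ⟨_, τ, hle, hcompl, hτ⟩

theorem IsLocallyCStable.mem_image_perp_iff (hG : IsLocallyCStable G) {γ : LocalClass G} :
    γ ∈ LocalClass.perp '' structureLattice G ↔ γ ∈ structureLattice G ∧ γ.perp.perp = γ := by
  constructor
  · rintro ⟨α, hα, rfl⟩
    exact ⟨hG.perp_mem_structureLattice hα, hG.perp_perp_perp hα⟩
  · rintro ⟨hγ, h⟩
    exact ⟨γ.perp, hG.perp_mem_structureLattice hγ, h⟩

theorem IsLocallyCStable.bot_perp_perp (hG : IsLocallyCStable G) :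
    (⊥ : LocalClass G).perp.perp = ⊥ := by
  have hbot := bot_mem_structureLattice (G := G)
  have hbot' := hG.perp_mem_structureLattice hbot
  have hle : (⊥ : LocalClass G).perp.perp ≤ (⊥ : LocalClass G).perp :=
    (hG.inf_eq_bot_iff (hG.perp_mem_structureLattice hbot') hbot).1 (inf_bot_eq _)
  rw [← inf_eq_right.2 hle, hG.inf_perp_eq_bot hbot']

theorem IsLocallyCStable.isBooleanFamily_image_perp (hG : IsLocallyCStable G) :
    IsBooleanFamily (LocalClass.perp '' structureLattice G) where
  subset_structureLattice γ hγ := (hG.mem_image_perp_iff.1 hγ).1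
  bot_mem := hG.mem_image_perp_iff.2 ⟨bot_mem_structureLattice, hG.bot_perp_perp⟩
  inf_mem α hα β hβ := by
    rw [hG.mem_image_perp_iff] at hα hβ ⊢
    have hαβ := inf_mem_structureLattice hα.1 hβ.1
    refine ⟨hαβ, le_antisymm (le_inf ?_ ?_) (hG.le_perp_perp hαβ)⟩
    · exact (LocalClass.perp_anti (LocalClass.perp_anti inf_le_left)).trans_eq hα.2
    · exact (LocalClass.perp_anti (LocalClass.perp_anti inf_le_right)).trans_eq hβ.2
  perp_mem α hα := ⟨α, (hG.mem_image_perp_iff.1 hα).1, rfl⟩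
  perp_perp α hα := (hG.mem_image_perp_iff.1 hα).2
  conj_mem := by
    rintro g _ ⟨α, hα, rfl⟩
    exact ⟨α.conj g, conj_mem_structureLattice hα g, LocalClass.perp_conj g α⟩

theorem range_centraliserLattice_cls (G : Type u) [Group G] [TopologicalSpace G] :
    Set.range (CentraliserLattice.cls (G := G)) = LocalClass.perp '' structureLattice G := by
  refine Subtype.range_coe.trans (Set.Subset.antisymm ?_ ?_)
  · rintro _ ⟨α, hα, rfl⟩
    exact ⟨α, hα, rfl⟩
  · rintro _ ⟨α, hα, rfl⟩
    exact ⟨α, hα, rfl⟩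

theorem IsLocallyCStable.exists_isLocalClassAction_centraliserLattice (hG : IsLocallyCStable G) :
    ∃ (_ : BooleanAlgebra (CentraliserLattice G))
      (τ : G →* (CentraliserLattice G ≃o CentraliserLattice G)),
      IsLocalClassAction τ CentraliserLattice.cls :=
  hG.isBooleanFamily_image_perp.exists_isLocalClassAction hG Subtype.val_injective
    (range_centraliserLattice_cls G)

theorem IsLocallyCStable.isBooleanFamily_decompositionClasses (hG : IsLocallyCStable G) :
    IsBooleanFamily (decompositionClasses G) where
  subset_structureLattice := by
    rintro _ ⟨K, M, h, rfl⟩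
    exact ⟨K, h.isLocallyNormal_left, rfl⟩
  bot_mem := bot_mem_decompositionClasses
  inf_mem _ hα _ hβ := hG.inf_mem_decompositionClasses hα hβ
  perp_mem _ hα := hG.perp_mem_decompositionClasses hα
  perp_perp _ hα := hG.perp_perp_of_mem_decompositionClasses hα
  conj_mem g _ hα := conj_mem_decompositionClasses hα g

theorem IsLocallyCStable.exists_isLocalClassAction_decompositionLattice (hG : IsLocallyCStable G) :
    ∃ (_ : BooleanAlgebra (DecompositionLattice G))
      (τ : G →* (DecompositionLattice G ≃o DecompositionLattice G)),
      IsLocalClassAction τ DecompositionLattice.cls :=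
  hG.isBooleanFamily_decompositionClasses.exists_isLocalClassAction hG Subtype.val_injective
    hG.range_decompositionLattice_cls

end BooleanFamilies

namespace StoneSpace

variable {A : Type v} [BooleanAlgebra A] {B : Type w} [BooleanAlgebra B]

theorem eq_of_subset {p q : StoneSpace A} (h : p.carrier ⊆ q.carrier) : p = q := by
  refine StoneSpace.ext (Set.Subset.antisymm h fun a haq => ?_)
  by_contra hap
  exact (q.compl_mem_iff a).1 (h ((p.compl_mem_iff a).2 hap)) haq

theorem bot_notMem (p : StoneSpace A) : ⊥ ∉ p.carrier := by
  rw [← compl_top, p.compl_mem_iff, not_not]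
  exact p.top_mem

theorem sup_mem_iff (p : StoneSpace A) {a b : A} :
    a ⊔ b ∈ p.carrier ↔ a ∈ p.carrier ∨ b ∈ p.carrier := by
  refine ⟨fun h => ?_, fun h => h.elim (fun ha => p.mem_of_le a ha _ le_sup_left)
    fun hb => p.mem_of_le b hb _ le_sup_right⟩
  by_contra! hab
  refine (p.compl_mem_iff (a ⊔ b)).1 ?_ h
  rw [compl_sup]
  exact p.inf_mem _ ((p.compl_mem_iff a).2 hab.1) _ ((p.compl_mem_iff b).2 hab.2)

/-- The complement of a prime ideal is an ultrafilter. -/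
def ofPrimeIdeal (J : Order.Ideal A) (hJ : J.IsPrime) : StoneSpace A where
  carrier := {a | a ∉ J}
  top_mem := hJ.toIsProper.top_notMem
  inf_mem a ha b hb h := (hJ.mem_or_mem h).elim ha hb
  mem_of_le a ha b hab h := ha (J.lower hab h)
  compl_mem_iff a := by
    refine ⟨fun hac ha => ?_, fun ha hac => hJ.toIsProper.top_notMem ?_⟩
    · have ha' : a ∈ J := (hJ.mem_or_mem (inf_compl_eq_bot (a := a) ▸ J.bot_mem)).resolve_right hac
      exact ha ha'
    · rw [← sup_compl_eq_top (x := a)]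
      exact Order.Ideal.sup_mem (not_not.1 ha) hac

theorem exists_forall_mem_notMem_ideal (I : Order.Ideal A) (hI : ⊤ ∉ I) :
    ∃ p : StoneSpace A, ∀ a ∈ p.carrier, a ∉ I := by
  have hdisj : Disjoint (Order.PFilter.principal (⊤ : A) : Set A) I :=
    Set.disjoint_left.2 fun a ha haI => hI (top_le_iff.1 ha ▸ haI)
  obtain ⟨J, hJ, hIJ, -⟩ := DistribLattice.prime_ideal_of_disjoint_filter_ideal hdisj
  exact ⟨ofPrimeIdeal J hJ, fun a ha haI => ha (hIJ haI)⟩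

theorem exists_mem_of_ne_bot {a : A} (ha : a ≠ ⊥) : ∃ p : StoneSpace A, a ∈ p.carrier := by
  obtain ⟨p, hp⟩ := exists_forall_mem_notMem_ideal (Order.Ideal.principal aᶜ)
    fun h => ha (compl_eq_top.1 (top_le_iff.1 h))
  refine ⟨p, ?_⟩
  by_contra hap
  exact hp aᶜ ((p.compl_mem_iff a).2 hap) (le_refl aᶜ)

theorem isTopologicalBasis : TopologicalSpace.IsTopologicalBasis
    {s | ∃ a : A, s = {p : StoneSpace A | a ∈ p.carrier}} where
  exists_subset_inter := by
    rintro _ ⟨a, rfl⟩ _ ⟨b, rfl⟩ p ⟨ha, hb⟩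
    exact ⟨_, ⟨a ⊓ b, rfl⟩, p.inf_mem a ha b hb,
      fun q hq => ⟨q.mem_of_le _ hq _ inf_le_left, q.mem_of_le _ hq _ inf_le_right⟩⟩
  sUnion_eq := Set.eq_univ_of_forall fun p => ⟨_, ⟨⊤, rfl⟩, p.top_mem⟩
  eq_generateFrom := rfl

theorem isOpen_setOf_mem (a : A) : IsOpen {p : StoneSpace A | a ∈ p.carrier} :=
  TopologicalSpace.isOpen_generateFrom_of_mem ⟨a, rfl⟩

theorem isClopen_setOf_mem (a : A) : IsClopen {p : StoneSpace A | a ∈ p.carrier} := by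
  refine ⟨⟨?_⟩, isOpen_setOf_mem a⟩
  convert isOpen_setOf_mem aᶜ using 1
  ext p
  exact (p.compl_mem_iff a).symm

theorem setOf_mem_subset_iff {a b : A} :
    {p : StoneSpace A | a ∈ p.carrier} ⊆ {p : StoneSpace A | b ∈ p.carrier} ↔ a ≤ b := by
  refine ⟨fun h => ?_, fun h p hp => p.mem_of_le a hp b h⟩
  by_contra hab
  have hne : a ⊓ bᶜ ≠ ⊥ := by rwa [Ne, ← disjoint_iff, disjoint_compl_right_iff]
  obtain ⟨p, hp⟩ := exists_mem_of_ne_bot hne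
  exact (p.compl_mem_iff b).1 (p.mem_of_le _ hp _ inf_le_right)
    (h (p.mem_of_le _ hp _ inf_le_left))

instance : T2Space (StoneSpace A) := by
  refine ⟨fun p q hpq => ?_⟩
  obtain ⟨a, hap, haq⟩ := Set.not_subset.1 fun h => hpq (eq_of_subset h)
  refine ⟨_, _, isOpen_setOf_mem a, isOpen_setOf_mem aᶜ, hap, (q.compl_mem_iff a).2 haq, ?_⟩
  exact Set.disjoint_left.2 fun r hr hr' => (r.compl_mem_iff a).1 hr' hr

/-- The ideal of the elements of the algebra whose basic open set lies in `S`. -/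
def idealOfSubset (S : Set (StoneSpace A)) : Order.Ideal A :=
  Order.IsIdeal.toIdeal (I := {a : A | {p : StoneSpace A | a ∈ p.carrier} ⊆ S})
    { IsLowerSet := fun _ _ hba ha => (setOf_mem_subset_iff.2 hba).trans ha
      Nonempty := ⟨⊥, fun p hp => (p.bot_notMem hp).elim⟩
      Directed := fun a ha b hb => ⟨a ⊔ b, fun p hp => (p.sup_mem_iff.1 hp).elim (@ha p) (@hb p),
        le_sup_left, le_sup_right⟩ }

theorem exists_setOf_mem_eq_of_isClopen {S : Set (StoneSpace A)} (hS : IsClopen S) :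
    ∃ a : A, {p : StoneSpace A | a ∈ p.carrier} = S := by
  have htop : ⊤ ∈ idealOfSubset S ⊔ idealOfSubset Sᶜ := by
    by_contra htop
    obtain ⟨p, hp⟩ := exists_forall_mem_notMem_ideal _ htop
    by_cases hpS : p ∈ S
    · obtain ⟨_, ⟨a, rfl⟩, hpa, haS⟩ := isTopologicalBasis.exists_subset_of_mem_open hpS hS.isOpen
      exact hp a hpa ((le_sup_left : idealOfSubset S ≤ _) haS)
    · obtain ⟨_, ⟨a, rfl⟩, hpa, haS⟩ :=
        isTopologicalBasis.exists_subset_of_mem_open (Set.mem_compl hpS) hS.compl.isOpen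
      exact hp a hpa ((le_sup_right : idealOfSubset Sᶜ ≤ _) haS)
  obtain ⟨a, ha, b, hb, hab⟩ := Order.Ideal.mem_sup.1 htop
  refine ⟨a, Set.Subset.antisymm ha fun p hp => ?_⟩
  have hpab : a ⊔ b ∈ p.carrier := p.mem_of_le _ p.top_mem _ hab
  exact (p.sup_mem_iff.1 hpab).resolve_right fun hpb => hb hpb hp

/-- Stone duality: a Boolean algebra is the algebra of clopen subsets of its Stone space. -/
noncomputable def clopensIso (A : Type v) [BooleanAlgebra A] :
    A ≃o TopologicalSpace.Clopens (StoneSpace A) :=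
  RelIso.ofSurjective
    (OrderEmbedding.ofMapLEIff (fun a => ⟨{p | a ∈ p.carrier}, isClopen_setOf_mem a⟩)
      fun _ _ => setOf_mem_subset_iff)
    fun s => (exists_setOf_mem_eq_of_isClopen s.isClopen).imp
      fun _ => TopologicalSpace.Clopens.ext

theorem clopenHom_stoneHom_clopensIso (e : A ≃o A) (a : A) :
    clopenHom (StoneSpace A) (stoneHom A e) (clopensIso A a) = clopensIso A (e a) :=
  rfl

theorem stoneHom_injective : Function.Injective (stoneHom A) := by
  intro e e' h
  refine RelIso.ext fun a => (clopensIso A).injective ?_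
  rw [← clopenHom_stoneHom_clopensIso, ← clopenHom_stoneHom_clopensIso, h]

/-- The map of Stone spaces dual to a homomorphism of Boolean algebras. -/
def comap (f : BoundedLatticeHom A B) (p : StoneSpace B) : StoneSpace A where
  carrier := f ⁻¹' p.carrier
  top_mem := by simpa only [Set.mem_preimage, map_top] using p.top_mem
  inf_mem a ha b hb := by simpa only [Set.mem_preimage, map_inf] using p.inf_mem _ ha _ hb
  mem_of_le a ha b hab := p.mem_of_le _ ha _ (OrderHomClass.mono f hab)
  compl_mem_iff a := by simpa only [Set.mem_preimage, map_compl'] using p.compl_mem_iff (f a)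

theorem continuous_comap (f : BoundedLatticeHom A B) : Continuous (comap f) := by
  refine continuous_generateFrom_iff.2 ?_
  rintro _ ⟨a, rfl⟩
  exact isOpen_setOf_mem (f a)

theorem comap_surjective {f : BoundedLatticeHom A B} (hf : Function.Injective f) :
    Function.Surjective (comap f) := by
  intro q
  let I : Order.Ideal B := Order.IsIdeal.toIdeal (I := {b : B | ∃ a ∉ q.carrier, b ≤ f a})
    { IsLowerSet := fun b c hcb ⟨a, ha, hb⟩ => ⟨a, ha, hcb.trans hb⟩
      Nonempty := ⟨⊥, ⊥, q.bot_notMem, bot_le⟩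
      Directed := by
        rintro b ⟨a, ha, hb⟩ b' ⟨a', ha', hb'⟩
        refine ⟨f a ⊔ f a', ⟨a ⊔ a', ?_, (map_sup f a a').ge⟩, le_sup_of_le_left hb,
          le_sup_of_le_right hb'⟩
        rw [q.sup_mem_iff, not_or]
        exact ⟨ha, ha'⟩ }
  have hI : ⊤ ∉ I := by
    rintro ⟨a, ha, htop⟩
    rw [top_le_iff, ← map_top f, hf.eq_iff] at htop
    exact ha (htop ▸ q.top_mem)
  obtain ⟨p, hp⟩ := exists_forall_mem_notMem_ideal I hI
  refine ⟨p, eq_of_subset fun a ha => ?_⟩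
  by_contra haq
  exact hp _ ha ⟨a, haq, le_rfl⟩

end StoneSpace

section ClopenUltrafilter

open TopologicalSpace (Clopens)

variable {X : Type v} [TopologicalSpace X]

/-- The ultrafilter of the clopen sets that contain a given point. -/
def clopenUltrafilter (x : X) : StoneSpace (Clopens X) where
  carrier := {s | x ∈ s}
  top_mem := trivial
  inf_mem _ hs _ ht := ⟨hs, ht⟩
  mem_of_le _ hs _ hst := hst hs
  compl_mem_iff _ := Iff.rfl

theorem continuous_clopenUltrafilter : Continuous (clopenUltrafilter (X := X)) := by
  refine continuous_generateFrom_iff.2 ?_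
  rintro _ ⟨s, rfl⟩
  exact s.isClopen.isOpen

theorem denseRange_clopenUltrafilter : DenseRange (clopenUltrafilter (X := X)) := by
  refine StoneSpace.isTopologicalBasis.dense_iff.2 ?_
  rintro _ ⟨s, rfl⟩ ⟨p, hp⟩
  obtain ⟨x, hx⟩ : (s : Set X).Nonempty := by
    rw [Set.nonempty_iff_ne_empty]
    intro hs
    exact p.bot_notMem ((Clopens.ext hs : s = ⊥) ▸ hp)
  exact ⟨_, hx, x, rfl⟩

theorem clopenUltrafilter_injective [TotallySeparatedSpace X] :
    Function.Injective (clopenUltrafilter (X := X)) := by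
  intro x y h
  by_contra hxy
  obtain ⟨s, hs, hx, hy⟩ := exists_isClopen_of_totally_separated hxy
  have hmem : (⟨s, hs⟩ : Clopens X) ∈ (clopenUltrafilter x).carrier := hx
  rw [h] at hmem
  exact hy hmem

theorem stoneHom_clopenHom_clopenUltrafilter (h : X ≃ₜ X) (x : X) :
    stoneHom (Clopens X) (clopenHom X h) (clopenUltrafilter x) = clopenUltrafilter (h x) :=
  rfl

theorem clopenHom_injective [TotallySeparatedSpace X] : Function.Injective (clopenHom X) := by
  intro h h' hh'
  refine Homeomorph.ext fun x => clopenUltrafilter_injective ?_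
  rw [← stoneHom_clopenHom_clopenUltrafilter, hh', stoneHom_clopenHom_clopenUltrafilter]

theorem clopenUltrafilter_surjective [CompactSpace X] :
    Function.Surjective (clopenUltrafilter (X := X)) := by
  rw [← Set.range_eq_univ, ← denseRange_clopenUltrafilter.closure_range]
  exact (isCompact_range continuous_clopenUltrafilter).isClosed.closure_eq.symm

/-- Stone duality: a profinite space is the Stone space of its algebra of clopen subsets. -/
noncomputable def stoneHomeomorph (X : Type v) [TopologicalSpace X] [CompactSpace X]
    [TotallySeparatedSpace X] : X ≃ₜ StoneSpace (Clopens X) :=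
  Continuous.homeoOfEquivCompactToT2
    (f := Equiv.ofBijective clopenUltrafilter
      ⟨clopenUltrafilter_injective, clopenUltrafilter_surjective⟩)
    continuous_clopenUltrafilter

end ClopenUltrafilter

section Transport

variable {A : Type v} [BooleanAlgebra A] {B : Type w} [BooleanAlgebra B]

/-- A map of Boolean algebras preserving `⊥`, meets and complements, as a homomorphism. -/
def boundedLatticeHomOfCompl (f : A → B) (map_bot : f ⊥ = ⊥)
    (map_inf : ∀ a b, f (a ⊓ b) = f a ⊓ f b) (map_compl : ∀ a, f aᶜ = (f a)ᶜ) :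
    BoundedLatticeHom A B where
  toFun := f
  map_sup' a b := by
    rw [← compl_compl (a ⊔ b), compl_sup, map_compl, map_inf, map_compl, map_compl, ← compl_sup,
      compl_compl]
  map_inf' := map_inf
  map_top' := by rw [← compl_bot, map_compl, map_bot, compl_bot]
  map_bot' := map_bot

variable {G : Type u} [Group G]

theorem occursOnSubalgebra_iff {ρ : G →* (A ≃o A)} {τ : G →* (B ≃o B)} :
    OccursOnSubalgebra ρ τ ↔ ∃ f : BoundedLatticeHom A B, Function.Injective f ∧
      ∀ g a, f (ρ g a) = τ g (f a) := by
  constructor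
  · rintro ⟨C, -, e, he⟩
    exact ⟨C.subtype.comp (e : BoundedLatticeHom A C), Subtype.val_injective.comp e.injective, he⟩
  · rintro ⟨f, hf, hfτ⟩
    let e : A ↪o BooleanSubalgebra.map f ⊤ :=
      OrderEmbedding.ofMapLEIff (fun a => ⟨f a, a, trivial, rfl⟩)
        fun _ _ => (orderEmbeddingOfInjective f hf).le_iff_le
    refine ⟨BooleanSubalgebra.map f ⊤, ?_, RelIso.ofSurjective e ?_, hfτ⟩
    · rintro g _ ⟨a, -, rfl⟩
      exact ⟨ρ g a, trivial, hfτ g a⟩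
    · rintro ⟨_, a, -, rfl⟩
      exact ⟨a, rfl⟩

theorem OccursOnSubalgebra.isQuotientOfStoneSpace {ρ : G →* (A ≃o A)} {τ : G →* (B ≃o B)}
    (h : OccursOnSubalgebra ρ τ) : IsQuotientOfStoneSpace τ ((stoneHom A).comp ρ) := by
  obtain ⟨f, hf, hfτ⟩ := occursOnSubalgebra_iff.1 h
  refine ⟨StoneSpace.comap f, StoneSpace.continuous_comap f, StoneSpace.comap_surjective hf,
    fun g p => StoneSpace.ext (Set.ext fun a => ?_)⟩
  have hsymm : (τ g).symm (f a) = f ((ρ g).symm a) := by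
    rw [OrderIso.symm_apply_eq, ← hfτ, OrderIso.apply_symm_apply]
  exact iff_of_eq (congrArg (· ∈ p.carrier) hsymm)

theorem IsQuotientOfStoneSpace.of_clopens {X : Type w} [TopologicalSpace X] [CompactSpace X]
    [TotallySeparatedSpace X] {τ : G →* (A ≃o A)} {σ : G →* (X ≃ₜ X)}
    (h : IsQuotientOfStoneSpace τ
      ((stoneHom (TopologicalSpace.Clopens X)).comp ((clopenHom X).comp σ))) :
    IsQuotientOfStoneSpace τ σ := by
  obtain ⟨f, hf, hsurj, hfσ⟩ := h
  refine ⟨(stoneHomeomorph X).symm ∘ f, (stoneHomeomorph X).symm.continuous.comp hf,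
    (stoneHomeomorph X).symm.surjective.comp hsurj, fun g p => ?_⟩
  obtain ⟨x, hx⟩ := (stoneHomeomorph X).surjective (f p)
  rw [Function.comp_apply, Function.comp_apply, hfσ, ← hx, Homeomorph.symm_apply_apply,
    Homeomorph.symm_apply_eq]
  exact stoneHom_clopenHom_clopenUltrafilter (σ g) x

variable [TopologicalSpace G]

theorem IsWeaklyBranch.of_orderIso {ρ : G →* (A ≃o A)} {τ : G →* (B ≃o B)} (h : IsWeaklyBranch ρ)
    (e : A ≃o B) (he : ∀ g a, τ g (e a) = e (ρ g a)) : IsWeaklyBranch τ := by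
  have fixed_iff : ∀ g a, τ g (e a) = e a ↔ ρ g a = a := fun g a => by
    rw [he, e.injective.eq_iff]
  refine ⟨e.surjective.forall.2 fun a => ?_, e.surjective.forall.2 fun a ha => ?_⟩
  · simpa only [fixed_iff] using h.1 a
  · obtain ⟨g, hg, hgker⟩ := h.2 a fun ha' => ha (by rw [ha', map_bot])
    refine ⟨g, e.surjective.forall.2 fun b hb => ?_, fun hker => hgker (RelIso.ext fun b => ?_)⟩
    · rw [← map_compl' e, e.le_iff_le] at hb
      exact (fixed_iff g b).2 (hg b hb)
    · exact (fixed_iff g b).1 (by rw [MonoidHom.mem_ker.1 hker, RelIso.one_apply])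

theorem IsWeaklyBranch.stone {ρ : G →* (A ≃o A)} (h : IsWeaklyBranch ρ) :
    IsWeaklyBranch ((clopenHom (StoneSpace A)).comp ((stoneHom A).comp ρ)) :=
  h.of_orderIso (StoneSpace.clopensIso A) fun g =>
    StoneSpace.clopenHom_stoneHom_clopensIso (ρ g)

end Transport

section RigidStabilisers

variable {G : Type u} [Group G] {A : Type v} [BooleanAlgebra A] {ρ : G →* (A ≃o A)}

theorem rist_mono {a b : A} (h : a ≤ b) : rist ρ a ≤ rist ρ b :=
  fun _ hg c hc => hg c (hc.trans (compl_le_compl h))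

theorem rist_inf (a b : A) : rist ρ (a ⊓ b) = rist ρ a ⊓ rist ρ b := by
  refine le_antisymm (le_inf (rist_mono inf_le_left) (rist_mono inf_le_right)) ?_
  rintro g ⟨ha, hb⟩ c hc
  have hsplit : c = c ⊓ aᶜ ⊔ c ⊓ bᶜ := by
    rw [← inf_sup_left, ← compl_inf, inf_eq_left.2 hc]
  rw [hsplit, map_sup, ha _ inf_le_right, hb _ inf_le_right]

theorem rist_bot : rist ρ ⊥ = ρ.ker := by
  ext g
  refine ⟨fun hg => RelIso.ext fun b => hg b (le_top.trans_eq compl_bot.symm), fun hg b _ => ?_⟩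
  rw [MonoidHom.mem_ker.1 hg, RelIso.one_apply]

theorem rist_inf_rist_compl (a : A) : rist ρ a ⊓ rist ρ aᶜ = ρ.ker := by
  rw [← rist_inf, inf_compl_eq_bot, rist_bot]

theorem map_conj_rist_le (g : G) (a : A) :
    (rist ρ a).map (MulAut.conj g).toMonoidHom ≤ rist ρ (ρ g a) := by
  rintro _ ⟨x, hx, rfl⟩ b hb
  have hb' : (ρ g)⁻¹ b ≤ aᶜ := by
    rw [← map_compl' (ρ g)] at hb
    exact (OrderIso.symm_apply_le (ρ g)).2 hb
  change ρ (g * x * g⁻¹) b = b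
  rw [map_mul, map_mul, map_inv, RelIso.mul_apply, RelIso.mul_apply, hx _ hb',
    RelIso.apply_inv_self]

theorem map_conj_rist (g : G) (a : A) :
    (rist ρ a).map (MulAut.conj g).toMonoidHom = rist ρ (ρ g a) := by
  refine le_antisymm (map_conj_rist_le g a) fun x hx => ⟨g⁻¹ * x * g, ?_, ?_⟩
  · have h := map_conj_rist_le g⁻¹ (ρ g a) ⟨x, hx, rfl⟩
    rw [map_inv, RelIso.inv_apply_self] at h
    simpa using h
  · simp [mul_assoc]

theorem mem_normalizer_rist {a : A} {g : G} (hg : ρ g a = a) :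
    g ∈ Subgroup.normalizer (rist ρ a : Set G) := by
  rw [Subgroup.mem_normalizer_iff_map_conj_eq]
  exact (map_conj_rist g a).trans (congrArg (rist ρ) hg)

theorem rist_le_centralizer (hρ : Function.Injective ρ) (a : A) :
    rist ρ a ≤ Subgroup.centralizer (rist ρ aᶜ : Set G) := by
  refine le_centralizer_of_inf_eq_bot (fun g hg => mem_normalizer_rist (hg aᶜ le_rfl))
    (fun g hg => mem_normalizer_rist (hg a (compl_compl a).ge)) ?_
  rw [rist_inf_rist_compl, (MonoidHom.ker_eq_bot_iff ρ).2 hρ]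

theorem exists_inf_map_eq_bot {e : A ≃o A} {b : A} (h : e b ≠ b) :
    ∃ c ≤ b, c ≠ ⊥ ∧ c ⊓ e c = ⊥ := by
  by_cases hle : b ≤ e b
  · have hcb : e.symm (e b \ b) ≤ b := by
      rw [e.symm_apply_le]
      exact sdiff_le
    refine ⟨e.symm (e b \ b), hcb, fun h0 => h (le_antisymm ?_ hle), ?_⟩
    · rwa [map_eq_bot_iff, sdiff_eq_bot_iff] at h0
    · rw [e.apply_symm_apply, ← disjoint_iff]
      exact disjoint_sdiff_self_right.mono_left hcb
  · refine ⟨b \ e b, sdiff_le, fun h0 => hle (sdiff_eq_bot_iff.1 h0), ?_⟩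
    rw [← disjoint_iff]
    exact disjoint_sdiff_self_left.mono_right (e.monotone sdiff_le)

variable [TopologicalSpace G]

/-- The stabiliser of a point under a smooth action. -/
def IsSmooth.stabilizer (hρ : IsSmooth ρ) (a : A) : OpenSubgroup G where
  toSubgroup := (MulAction.stabilizer (A ≃o A) a).comap ρ
  isOpen' := hρ a

theorem IsSmooth.isClosed_rist [ContinuousMul G] (hρ : IsSmooth ρ) (a : A) :
    IsClosed (rist ρ a : Set G) := by
  have hrist : (rist ρ a : Set G) = ⋂ b ≤ aᶜ, (hρ.stabilizer b : Set G) := by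
    ext g
    simp only [Set.mem_iInter]
    exact Iff.rfl
  rw [hrist]
  exact isClosed_biInter fun b _ => (hρ.stabilizer b).isClosed

theorem IsSmooth.isOpen_normalizer_rist [ContinuousMul G] (hρ : IsSmooth ρ) (a : A) :
    IsOpen (Subgroup.normalizer (rist ρ a : Set G) : Set G) :=
  Subgroup.isOpen_mono (H₁ := hρ.stabilizer a) (fun _ hg => mem_normalizer_rist hg)
    (hρ.stabilizer a).isOpen

variable [IsTopologicalGroup G]

theorem IsWeaklyBranch.mk_rist_eq_bot_iff (hρ : IsWeaklyBranch ρ) (hi : Function.Injective ρ)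
    (hG : TrivialQuasiCentre G) {a : A} : LocalClass.mk (rist ρ a) = ⊥ ↔ a = ⊥ := by
  rw [hG.mk_eq_bot_iff (hρ.1.isOpen_normalizer_rist a)]
  constructor
  · refine fun h => not_not.1 fun ha => ?_
    obtain ⟨g, hg, hgker⟩ := hρ.2 a ha
    rw [h, Subgroup.mem_bot] at hg
    exact hgker (hg ▸ one_mem _)
  · rintro rfl
    rw [rist_bot, (MonoidHom.ker_eq_bot_iff ρ).2 hi]

theorem IsWeaklyBranch.mk_rist_le_mk_rist_iff (hρ : IsWeaklyBranch ρ) (hi : Function.Injective ρ)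
    (hG : TrivialQuasiCentre G) {a b : A} :
    LocalClass.mk (rist ρ a) ≤ LocalClass.mk (rist ρ b) ↔ a ≤ b := by
  refine ⟨fun h => ?_, fun h => LocalClass.mk_mono (rist_mono h)⟩
  rw [← disjoint_compl_right_iff, disjoint_iff, ← hρ.mk_rist_eq_bot_iff hi hG, ← le_bot_iff]
  calc LocalClass.mk (rist ρ (a ⊓ bᶜ))
      = LocalClass.mk (rist ρ a) ⊓ LocalClass.mk (rist ρ bᶜ) := by
        rw [rist_inf, LocalClass.mk_inf_mk]
    _ ≤ LocalClass.mk (rist ρ b) ⊓ LocalClass.mk (rist ρ bᶜ) := inf_le_inf_right _ h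
    _ = ⊥ := by
        rw [LocalClass.mk_inf_mk, rist_inf_rist_compl, (MonoidHom.ker_eq_bot_iff ρ).2 hi]
        rfl

/-- An element `g` moving some `b ≤ a` moves some nonzero `c ≤ b` off itself, and then cannot
centralise a neighbourhood of `1` in `rist(c)`, as `rist(c) ∩ rist(g c)` is trivial. -/
theorem IsWeaklyBranch.quasiCentraliser_rist (hρ : IsWeaklyBranch ρ) (hi : Function.Injective ρ)
    (hG : TrivialQuasiCentre G) (a : A) : quasiCentraliser ⊤ (rist ρ a) = rist ρ aᶜ := by
  refine le_antisymm ?_ ((Subgroup.le_centralizer_iff.1 (rist_le_centralizer hi a)).trans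
    ((Subgroup.centralizer_le inf_le_left).trans (centralizer_le_quasiCentraliser _ ⊤)))
  rintro g ⟨-, V, hV⟩ b hb
  rw [compl_compl] at hb
  by_contra hne
  obtain ⟨c, hcb, hc0, hc⟩ := exists_inf_map_eq_bot hne
  refine hc0 ((hρ.mk_rist_eq_bot_iff hi hG).1 (LocalClass.mk_eq_bot_iff.2 ⟨V, ?_⟩))
  rw [← le_bot_iff, ← (MonoidHom.ker_eq_bot_iff ρ).2 hi, ← rist_bot, ← hc, rist_inf]
  refine fun x hx => ⟨hx.1, ?_⟩
  have hcomm : x * g = g * x := hV x ⟨rist_mono (hcb.trans hb) hx.1, hx.2⟩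
  have hconj := map_conj_rist_le g c ⟨x, hx.1, rfl⟩
  change g * x * g⁻¹ ∈ _ at hconj
  rwa [← hcomm, mul_inv_cancel_right] at hconj

theorem IsWeaklyBranch.mk_rist_compl (hρ : IsWeaklyBranch ρ) (hi : Function.Injective ρ)
    (hG : TrivialQuasiCentre G) (a : A) :
    LocalClass.mk (rist ρ aᶜ) = (LocalClass.mk (rist ρ a)).perp :=
  congrArg LocalClass.mk (hρ.quasiCentraliser_rist hi hG a).symm

theorem IsWeaklyBranch.occursOnSubalgebra (hρ : IsWeaklyBranch ρ) (hi : Function.Injective ρ)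
    (hG : TrivialQuasiCentre G) {B : Type w} [BooleanAlgebra B] {τ : G →* (B ≃o B)}
    {cls : B → LocalClass G} (hτ : IsLocalClassAction τ cls)
    (hmem : ∀ a, LocalClass.mk (rist ρ a) ∈ Set.range cls) : OccursOnSubalgebra ρ τ := by
  choose f hf using hmem
  have f_le_iff : ∀ a b, f a ≤ f b ↔ a ≤ b := fun a b => by
    rw [hτ.le_iff, hf, hf, hρ.mk_rist_le_mk_rist_iff hi hG]
  have f_bot : f ⊥ = ⊥ := by
    rw [← le_bot_iff, hτ.le_iff, hf, (hρ.mk_rist_eq_bot_iff hi hG).2 rfl]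
    exact bot_le
  have f_inf : ∀ a b, f (a ⊓ b) = f a ⊓ f b := fun a b => by
    refine le_antisymm (le_inf ((f_le_iff _ _).2 inf_le_left) ((f_le_iff _ _).2 inf_le_right)) ?_
    rw [hτ.le_iff, hf, rist_inf, ← LocalClass.mk_inf_mk, ← hf, ← hf]
    exact le_inf ((hτ.le_iff _ _).1 inf_le_left) ((hτ.le_iff _ _).1 inf_le_right)
  have f_compl : ∀ a, f aᶜ = (f a)ᶜ := fun a => hτ.injective <| by
    rw [hτ.cls_compl, hf, hf, hρ.mk_rist_compl hi hG]
  refine occursOnSubalgebra_iff.2 ⟨boundedLatticeHomOfCompl f f_bot f_inf f_compl,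
    (OrderEmbedding.ofMapLEIff f f_le_iff).injective, fun g a => hτ.injective ?_⟩
  change cls (f (ρ g a)) = cls (τ g (f a))
  rw [hτ.cls_map, hf, hf, ← map_conj_rist]
  rfl

theorem HasLocallyOpenRistProducts.mk_rist_mem_decompositionClasses
    (h : HasLocallyOpenRistProducts ρ) (hρ : IsSmooth ρ) (hi : Function.Injective ρ) (a : A) :
    LocalClass.mk (rist ρ a) ∈ decompositionClasses G := by
  obtain ⟨U, hUo, hUc, hU⟩ := h a
  have hcomm : rist ρ a ⊓ U ≤ Subgroup.centralizer ((rist ρ aᶜ ⊓ U : Subgroup G) : Set G) :=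
    inf_le_left.trans ((rist_le_centralizer hi a).trans (Subgroup.centralizer_le inf_le_left))
  rw [← LocalClass.mk_inf_openSubgroup _ ⟨U, hUo⟩]
  refine ⟨rist ρ a ⊓ U, rist ρ aᶜ ⊓ U, ?_, rfl⟩
  exact
    { isCompact_left := hUc.inter_left (hρ.isClosed_rist a)
      isCompact_right := hUc.inter_left (hρ.isClosed_rist aᶜ)
      le_centralizer := hcomm
      isOpen := by rwa [coe_sup_of_le_centralizer hcomm] }

variable [LocallyCompactSpace G] [TotallyDisconnectedSpace G]

theorem IsSmooth.mk_rist_mem_structureLattice (hρ : IsSmooth ρ) (a : A) :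
    LocalClass.mk (rist ρ a) ∈ structureLattice G := by
  obtain ⟨U, hU, -⟩ := exists_isCompact_openSubgroup_subset (G := G) Filter.univ_mem
  exact ⟨rist ρ a ⊓ U, ⟨hU.inter_left (hρ.isClosed_rist a), Subgroup.isOpen_mono
    (le_normalizer_inf inf_le_left (inf_le_right.trans Subgroup.le_normalizer))
    ((hρ.isOpen_normalizer_rist a).inter U.isOpen)⟩, LocalClass.mk_inf_openSubgroup _ _⟩

theorem IsWeaklyBranch.mk_rist_mem_image_perp (hρ : IsWeaklyBranch ρ) (hi : Function.Injective ρ)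
    (hG : TrivialQuasiCentre G) (a : A) :
    LocalClass.mk (rist ρ a) ∈ LocalClass.perp '' structureLattice G :=
  ⟨_, hρ.1.mk_rist_mem_structureLattice aᶜ, by rw [← hρ.mk_rist_compl hi hG, compl_compl]⟩

theorem IsLocallyBranch.hasLocallyOpenRistProducts [SigmaCompactSpace G] (hρ : IsLocallyBranch ρ)
    (hi : Function.Injective ρ) : HasLocallyOpenRistProducts ρ := by
  intro a
  obtain ⟨U, hU, -⟩ := exists_isCompact_openSubgroup_subset (G := G) Filter.univ_mem
  have hσ : ∀ b, SigmaCompactSpace (rist ρ b) := fun b =>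
    (hρ.1.1.isClosed_rist b).isClosedEmbedding_subtypeVal.sigmaCompactSpace
  refine ⟨U, U.isOpen, hU, isOpen_inter_mul_inter_of_isOpen_sup (rist_le_centralizer hi a) ?_
    U.isOpen⟩
  rw [coe_sup_of_le_centralizer (rist_le_centralizer hi a)]
  exact hρ.2 a

theorem IsWeaklyBranch.occursOnSubalgebra_of_range_eq_image_perp (hρ : IsWeaklyBranch ρ)
    (hi : Function.Injective ρ) (hG : TrivialQuasiCentre G) {B : Type w} [BooleanAlgebra B]
    {τ : G →* (B ≃o B)} {cls : B → LocalClass G} (hτ : IsLocalClassAction τ cls)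
    (hcls : Set.range cls = LocalClass.perp '' structureLattice G) : OccursOnSubalgebra ρ τ :=
  hρ.occursOnSubalgebra hi hG hτ fun a => hcls ▸ hρ.mk_rist_mem_image_perp hi hG a

theorem IsLocallyBranch.occursOnSubalgebra_of_range_eq_decompositionClasses
    (hρ : IsLocallyBranch ρ) (hi : Function.Injective ρ) (hG : TrivialQuasiCentre G) {B : Type w}
    [BooleanAlgebra B] {τ : G →* (B ≃o B)} {cls : B → LocalClass G}
    (hτ : IsLocalClassAction τ cls) (hcls : Set.range cls = decompositionClasses G)
    (h : SigmaCompactSpace G ∨ HasLocallyOpenRistProducts ρ) : OccursOnSubalgebra ρ τ := by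
  have hloc : HasLocallyOpenRistProducts ρ := h.elim (fun _ => hρ.hasLocallyOpenRistProducts hi) id
  exact hρ.1.occursOnSubalgebra hi hG hτ fun a =>
    hcls ▸ hloc.mk_rist_mem_decompositionClasses hρ.1.1 hi a

end RigidStabilisers

section LocalClassActions

variable {G : Type u} [Group G] [TopologicalSpace G]

theorem isOpen_setOf_conj_eq_self [ContinuousMul G] {α : LocalClass G}
    (hα : α ∈ structureLattice G) : IsOpen {g : G | α.conj g = α} := by
  obtain ⟨H, hH, rfl⟩ := hα
  refine Subgroup.isOpen_mono
    (H₂ := (MulAction.stabilizer _ (LocalClass.mk H)).comap (LocalClass.conjHom G))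
    (fun g hg => ?_) hH.2
  exact congrArg LocalClass.mk (Subgroup.mem_normalizer_iff_map_conj_eq.1 hg)

theorem IsLocalClassAction.mem_rist [ContinuousMul G] {B : Type v} [BooleanAlgebra B]
    {τ : G →* (B ≃o B)} {cls : B → LocalClass G} (hτ : IsLocalClassAction τ cls) {b : B} {g : G}
    (hg : (cls b).perp ≤ LocalClass.mk (Subgroup.centralizer {g})) : g ∈ rist τ b := by
  intro c hc
  have hle : cls c ≤ (cls b).perp := by rwa [← hτ.cls_compl, ← hτ.le_iff]
  refine hτ.injective ?_
  rw [hτ.cls_map, LocalClass.conj_eq_self_of_le_mk_centralizer (hle.trans hg)]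

variable [IsTopologicalGroup G] [LocallyCompactSpace G] [TotallyDisconnectedSpace G]

theorem IsLocallyCStable.exists_perp_le_mk_centralizer (hG : IsLocallyCStable G)
    {α : LocalClass G} (hα : α ∈ structureLattice G) (hne : α ≠ ⊥) :
    ∃ g ≠ (1 : G), α.perp ≤ LocalClass.mk (Subgroup.centralizer {g}) := by
  obtain ⟨H, hH, rfl⟩ := hα
  obtain ⟨U, hU, hHU⟩ := hH.exists_isCompact_openSubgroup
  have hHUne : H ⊓ (U : Subgroup G) ≠ ⊥ := fun h => hne (LocalClass.mk_eq_bot_iff.2 ⟨U, h⟩)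
  obtain ⟨g, hg, hg1⟩ := (Subgroup.bot_or_exists_ne_one _).resolve_left hHUne
  refine ⟨g, hg1, ?_⟩
  rw [hG.perp_mk hH.1 hU hHU]
  exact LocalClass.mk_mono (inf_le_left.trans
    (Subgroup.centralizer_le (Set.singleton_subset_iff.2 hg)))

theorem IsLocalClassAction.isWeaklyBranch (hG : IsLocallyCStable G) {B : Type v}
    [BooleanAlgebra B] {τ : G →* (B ≃o B)} {cls : B → LocalClass G}
    (hτ : IsLocalClassAction τ cls) (hcls : ∀ b, cls b ∈ structureLattice G)
    (hi : Function.Injective τ) : IsWeaklyBranch τ := by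
  refine ⟨fun b => ?_, fun b hb => ?_⟩
  · have hstab : {g : G | τ g b = b} = {g : G | (cls b).conj g = cls b} :=
      Set.ext fun g => by
        simp only [Set.mem_ofPred_eq, ← hτ.cls_map, hτ.injective.eq_iff]
    rw [hstab]
    exact isOpen_setOf_conj_eq_self (hcls b)
  · have hne : cls b ≠ ⊥ := fun h =>
      hb (le_bot_iff.1 ((hτ.le_iff _ _).2 (h.trans_le bot_le)))
    obtain ⟨g, hg1, hg⟩ := hG.exists_perp_le_mk_centralizer (hcls b) hne
    exact ⟨g, hτ.mem_rist hg, fun hker => hg1 (hi (by rw [MonoidHom.mem_ker.1 hker, map_one]))⟩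

end LocalClassActions

end TDLC

theorem mainTheorem3 {G : Type*} [Group G] [TopologicalSpace G] [IsTopologicalGroup G]
    [LocallyCompactSpace G] [TotallyDisconnectedSpace G] (hG : IsLocallyCStable G) :
    -- `LC(G)` and `LD(G)` are Boolean algebras for the order on local classes, with complement
    -- `⊥`, and `G` acts on both by conjugation
    ∃ (_ : BooleanAlgebra (CentraliserLattice G)) (_ : BooleanAlgebra (DecompositionLattice G))
      (ρC : G →* (CentraliserLattice G ≃o CentraliserLattice G))
      (ρD : G →* (DecompositionLattice G ≃o DecompositionLattice G)),
      (∀ α β : CentraliserLattice G, α ≤ β ↔ α.cls ≤ β.cls) ∧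
      (∀ α : CentraliserLattice G, αᶜ.cls = α.cls.perp) ∧
      (∀ (g : G) (α : CentraliserLattice G), (ρC g α).cls = α.cls.conj g) ∧
      (∀ α β : DecompositionLattice G, α ≤ β ↔ α.cls ≤ β.cls) ∧
      (∀ α : DecompositionLattice G, αᶜ.cls = α.cls.perp) ∧
      (∀ (g : G) (α : DecompositionLattice G), (ρD g α).cls = α.cls.conj g) ∧
      -- if `G` acts faithfully on `LC(G)`, the action on its Stone space is faithful weakly branch
      (Function.Injective ρC →
        Function.Injective ((stoneHom (CentraliserLattice G)).comp ρC) ∧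
        IsWeaklyBranch ((clopenHom (StoneSpace (CentraliserLattice G))).comp
          ((stoneHom (CentraliserLattice G)).comp ρC))) ∧
      -- faithful weakly branch actions on Boolean algebras
      (∀ (A : Type*) [BooleanAlgebra A] (ρ : G →* (A ≃o A)),
        Function.Injective ρ → IsWeaklyBranch ρ →
        OccursOnSubalgebra ρ ρC ∧ IsQuotientOfStoneSpace ρC ((stoneHom A).comp ρ)) ∧
      -- faithful weakly branch actions on profinite spaces
      (∀ (X : Type*) [TopologicalSpace X] [CompactSpace X] [T2Space X] [TotallyDisconnectedSpace X]
        (σ : G →* (X ≃ₜ X)),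
        Function.Injective σ → IsWeaklyBranch ((clopenHom X).comp σ) →
        OccursOnSubalgebra ((clopenHom X).comp σ) ρC ∧
        IsQuotientOfStoneSpace ρC σ) ∧
      -- faithful locally branch actions on Boolean algebras
      (∀ (A : Type*) [BooleanAlgebra A] (ρ : G →* (A ≃o A)),
        Function.Injective ρ → IsLocallyBranch ρ →
        (SigmaCompactSpace G ∨ HasLocallyOpenRistProducts ρ) → OccursOnSubalgebra ρ ρD) ∧
      -- faithful locally branch actions on profinite spaces
      (∀ (X : Type*) [TopologicalSpace X] [CompactSpace X] [T2Space X] [TotallyDisconnectedSpace X]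
        (σ : G →* (X ≃ₜ X)),
        Function.Injective σ → IsLocallyBranch ((clopenHom X).comp σ) →
        (SigmaCompactSpace G ∨ HasLocallyOpenRistProducts ((clopenHom X).comp σ)) →
        OccursOnSubalgebra ((clopenHom X).comp σ) ρD) := by
  obtain ⟨BC, ρC, hC⟩ := hG.exists_isLocalClassAction_centraliserLattice
  obtain ⟨BD, ρD, hD⟩ := hG.exists_isLocalClassAction_decompositionLattice
  have hCrange := range_centraliserLattice_cls G
  have hDrange := hG.range_decompositionLattice_cls
  refine ⟨BC, BD, ρC, ρD, hC.le_iff, hC.cls_compl, hC.cls_map, hD.le_iff, hD.cls_compl, hD.cls_map,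
    fun hi => ⟨StoneSpace.stoneHom_injective.comp hi, (hC.isWeaklyBranch hG ?_ hi).stone⟩,
    fun A _ ρ hi hρ => ?_, fun X _ _ _ _ σ hi hσ => ?_, fun A _ ρ hi hρ h => ?_,
    fun X _ _ _ _ σ hi hσ h => ?_⟩
  · exact fun α => hG.isBooleanFamily_image_perp.subset_structureLattice (hCrange ▸ ⟨α, rfl⟩)
  · have hA := hρ.occursOnSubalgebra_of_range_eq_image_perp hi hG.1 hC hCrange
    exact ⟨hA, hA.isQuotientOfStoneSpace⟩
  · have hX := hσ.occursOnSubalgebra_of_range_eq_image_perp (clopenHom_injective.comp hi) hG.1 hC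
      hCrange
    exact ⟨hX, hX.isQuotientOfStoneSpace.of_clopens⟩
  · exact hρ.occursOnSubalgebra_of_range_eq_decompositionClasses hi hG.1 hD hDrange h
  · exact hσ.occursOnSubalgebra_of_range_eq_decompositionClasses (clopenHom_injective.comp hi) hG.1
      hD hDrange h
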